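/- **Theorem 5.** A single receiver is served in slots. At the beginning of a slot the buffer holds $x\ge 0$ packets and the channel condition is $s\in\mathcal S$; the channel conditions form a homogeneous Markov process on a measurable space $\mathcal S$ (for instance a finite-state Markov chain) that is not influenced by the scheduler. Transmitting $z$ packets costs power $$c(z,s)=z\,\tilde c_0(s)+\sum_{k=0}^{K-1}\bigl(\tilde c_{k+1}(s)-\tilde c_k(s)\bigr)\max\{z-\tilde z_k(s),0\},$$ where $0<\tilde c_0(s)\le\dots\le\tilde c_K(s)$, $0=\tilde z_{-1}(s)<\tilde z_0(s)<\dots<\tilde z_{K-1}(s)$, all measurable in $s$. Then $d>0$ packets are played out, and the holding cost $h(x+z-d)$ is paid, where $h:[0,\infty)\to[0,\infty)$ is convex and nondecreasing with $h(0)=0$ and $h(x)\to\infty$ as $x\to\infty$; the next buffer level is $x+z-d$. The peak power is $P$; let $\tilde z_{\max}(s)$ be the solution of $c(z,s)=P$, and assume $\tilde z_{\max}(s)\ge d$ and $\tilde z_{\max}(s)>\tilde z_{K-1}(s)$ for all $s$. Let $0\le\alpha<1$. Put $V_0=0$ and, for $n\ge1$, $x\ge 0$, $y\ge d$, $$\tilde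 g_n(y,s)=h(y-d)+\alpha\,\mathbb E[V_{n-1}(y-d,S')\mid S=s],\qquad V_n(x,s)=\min_{\max(0,d-x)\le z\le\tilde z_{\max}(s)}\{c(z,s)+\tilde g_n(x+z,s)\},$$ where $S'$ is the channel condition in the subsequent slot. For a function $g$ on $[d,\infty)\times\mathcal S$ with right derivative $g'^{+}$ in the first variable and $0\le k\le K$, let $b_k[g](s)=\max\{d,\inf\{b\ge d: g'^{+}(b,s)\ge-\tilde c_k(s)\}\}$, and let $b_{-1}[g](s)=\infty$. Write $b_{n,k}=b_k[\tilde g_n]$. The minima above are attained, the expectations are finite, and: (a) For all $x\ge0$ and $s$, $V_n(x,s)$ is nondecreasing in $n$ and converges to a finite limit $V_\infty(x,s)$. (b) $V_\infty(x,s)$ is convex in $x\in[0,\infty)$ for every $s$. (c) Let $\tilde g_\infty(y,s)=h(y-d)+\alpha\,\mathbb E[V_\infty(y-d,S')\mid S=s]$. Then $\tilde g_n(y,s)$, $n\ge 1$, is nondecreasing in $n$ and converges to $\tilde g_\infty(y,s)$ for all $y\ge d$ and $s$; for every $s$, $\tilde g_\infty(y,s)$ is convex in $y\in[d,\infty)$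 and tends to $\infty$ as $y\to\infty$. (d) Let $b_{\infty,k}=b_k[\tilde g_\infty]$. Then $b_{n,k}(s)\to b_{\infty,k}(s)$ as $n\to\infty$ for all $k\in\{-1,0,\dots,K\}$ and $s$. (e) For all $x\ge0$ and $s$, the $\alpha$-discounted cost optimality equation holds: $$V_\infty(x,s)=\min_{\max(0,d-x)\le z\le\tilde z_{\max}(s)}\bigl\{c(z,s)+h(x+z-d)+\alpha\,\mathbb E[V_\infty(x+z-d,S')\mid S=s]\bigr\},$$ and the minimum is attained at $z^*_\infty(x,s)$, which is well defined by $$z_\infty^*(x,s)=\begin{cases}\tilde z_{k-1}(s)&\text{if } b_{\infty,k}(s)-\tilde z_{k-1}(s)<x\le b_{\infty,k-1}(s)-\tilde z_{k-1}(s),\ 0\le k\le K,\\ b_{\infty,k}(s)-x&\text{if } b_{\infty,k}(s)-\tilde z_k(s)<x\le b_{\infty,k}(s)-\tilde z_{k-1}(s),\ 0\le k\le K-1,\\ b_{\infty,K}(s)-x&\text{if } b_{\infty,K}(s)-\tilde z_{\max}(s)<x\le b_{\infty,K}(s)-\tilde z_{K-1}(s),\\ \tilde z_{\max}(s)&\text{if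 } 0\le x\le b_{\infty,K}(s)-\tilde z_{\max}(s).\end{cases}$$ (f) The stationary policy $(z^*_\infty,z^*_\infty,\dots)$ is optimal for the infinite-horizon discounted problem: $z^*_\infty$ is measurable, and from every initial state $(x,s)$ with $x\ge0$ the policy satisfies the constraints $c(Z,S)\le P$ and $Z\ge\max\{0,d-X\}$ in every slot with probability one, and minimizes the limit as $N\to\infty$ of the expected $\alpha$-discounted sum of the costs $c(Z,S)+h(X+Z-d)$ over the first $N$ slots, among all history-dependent randomized policies that satisfy these constraints with probability one; the minimal cost is $V_\infty(x,s)$. -/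

import Mathlib

open Filter Topology MeasureTheory ProbabilityTheory

/-- Data of the single-receiver transmission scheduling problem. The channel condition is a
homogeneous Markov process on a measurable space `S` with transition kernel `kernel`; it evolves
independently of the scheduler's decisions. Only the slopes with index `≤ K` and the breakpoints
with index `< K` are used. -/
structure Model (S : Type*) [MeasurableSpace S] where
  /-- number of packets played out in every slot -/
  d : ℝ
  /-- peak power in every slot -/
  P : ℝ
  /-- discount factor -/
  α : ℝ
  /-- holding cost, a function on `[0, ∞)` -/
  h : ℝ → ℝ
  /-- every power-rate curve has `K + 1` linear segments -/
  K : ℕ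
  /-- `slope k s` is the slope of segment `k` in channel condition `s`, for `k = 0, …, K` -/
  slope : ℕ → S → ℝ
  /-- `brk k s` is the point where the slope changes from `slope k s` to `slope (k + 1) s`,
  for `k = 0, …, K - 1` -/
  brk : ℕ → S → ℝ
  /-- law of the next channel condition given the present one -/
  kernel : Kernel S S
  /-- the transition laws are probability measures -/
  markov : IsMarkovKernel kernel

attribute [instance] Model.markov

namespace Model

variable {S : Type*} [MeasurableSpace S]

/-- The power `c(z, s)` consumed by transmitting `z` packets in channel condition `s`. -/
noncomputable def c (M : Model S) (z : ℝ) (s : S) : ℝ :=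
  z * M.slope 0 s +
    ∑ k ∈ Finset.range M.K, (M.slope (k + 1) s - M.slope k s) * max (z - M.brk k s) 0

/-- The left end of segment `k`: `0` for `k = 0`, and the breakpoint of index `k - 1` otherwise. -/
def brkPrev (M : Model S) (k : ℕ) (s : S) : ℝ :=
  if k = 0 then 0 else M.brk (k - 1) s

/-- The largest number of packets that the power `P` allows in channel condition `s`: the unique
solution of `c(z, s) = P` (the curve is a strictly increasing bijection of the line under
`Assumptions`). -/
noncomputable def zmax (M : Model S) (s : S) : ℝ :=
  sInf {z : ℝ | M.c z s = M.P}

/-- Standing assumptions on the data. -/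
structure Assumptions (M : Model S) : Prop where
  d_pos : 0 < M.d
  α_nonneg : 0 ≤ M.α
  α_lt_one : M.α < 1
  h_convex : ConvexOn ℝ (Set.Ici 0) M.h
  h_nonneg : ∀ x, 0 ≤ x → 0 ≤ M.h x
  h_mono : MonotoneOn M.h (Set.Ici 0)
  h_tendsto : Tendsto M.h atTop atTop
  h_zero : M.h 0 = 0
  slope_pos : ∀ s, 0 < M.slope 0 s
  slope_mono : ∀ k, k < M.K → ∀ s, M.slope k s ≤ M.slope (k + 1) s
  brk_lt : ∀ k, k < M.K → ∀ s, M.brkPrev k s < M.brk k s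
  d_le_zmax : ∀ s, M.d ≤ M.zmax s
  brk_lt_zmax : ∀ s, M.brkPrev M.K s < M.zmax s
  slope_meas : ∀ k, k ≤ M.K → Measurable (M.slope k)
  brk_meas : ∀ k, k < M.K → Measurable (M.brk k)

/-- Feasible numbers of packets to transmit in state `(x, s)`. -/
def actions (M : Model S) (x : ℝ) (s : S) : Set ℝ :=
  {z | max 0 (M.d - x) ≤ z ∧ z ≤ M.zmax s}

/-- Holding cost plus discounted expected cost-to-go `W`, as a function of the buffer level `y`
after transmission and before playout:
`h(y - d) + α · E[W(y - d, S') | S = s]`. -/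
noncomputable def after (M : Model S) (W : ℝ → S → ℝ) (y : ℝ) (s : S) : ℝ :=
  M.h (y - M.d) + M.α * ∫ s', W (y - M.d) s' ∂(M.kernel s)

/-- The finite-horizon value functions, `n` slots remaining, by dynamic programming. -/
noncomputable def V (M : Model S) : ℕ → ℝ → S → ℝ
  | 0 => fun _ _ => 0
  | n + 1 => fun x s =>
      sInf ((fun z => M.c z s + M.after (M.V n) (x + z) s) '' M.actions x s)

/-- The functions `g̃_n`, for `n ≥ 1`. -/
noncomputable def g (M : Model S) (n : ℕ) : ℝ → S → ℝ :=
  M.after (M.V (n - 1))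

/-- The pointwise limit of the finite-horizon value functions. -/
noncomputable def Vinf (M : Model S) (x : ℝ) (s : S) : ℝ :=
  limUnder atTop (fun n => M.V n x s)

/-- The function `g̃_∞`. -/
noncomputable def ginf (M : Model S) : ℝ → S → ℝ :=
  M.after M.Vinf

/-- The critical number of index `k ≥ 0` attached to a function `G` on `[d, ∞) × S`:
`max {d, inf {b | G'⁺(b, s) ≥ -c̃_k(s)}}`. Here `G'⁺` is the right derivative in the first variable;
a point `b` where the difference quotients have no finite limit (that is, `b = d` with right
derivative `-∞`, when `G` is convex) is not in the set. -/
noncomputable def crit (M : Model S) (G : ℝ → S → ℝ) (k : ℕ) (s : S) : ℝ :=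
  max M.d (sInf {b : ℝ | M.d ≤ b ∧
    ∃ L : ℝ, HasDerivWithinAt (fun y => G y s) L (Set.Ioi b) b ∧ -M.slope k s ≤ L})

/-- The critical number of index `k - 1`, the one of index `-1` being `∞`. -/
noncomputable def critPrev (M : Model S) (G : ℝ → S → ℝ) (k : ℕ) (s : S) : EReal :=
  if k = 0 then ⊤ else (M.crit G (k - 1) s : EReal)

/-- `z` is the number of packets that the finite generalized base-stock policy with the critical
numbers of `G` prescribes in state `(x, s)`; the four alternatives are those of its piecewise
definition. -/
def IsBaseStock (M : Model S) (G : ℝ → S → ℝ) (x : ℝ) (s : S) (z : ℝ) : Prop :=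
  (∃ k, k ≤ M.K ∧ M.crit G k s - M.brkPrev k s < x ∧
      (x : EReal) ≤ M.critPrev G k s - (M.brkPrev k s : EReal) ∧ z = M.brkPrev k s) ∨
  (∃ k, k < M.K ∧ M.crit G k s - M.brk k s < x ∧ x ≤ M.crit G k s - M.brkPrev k s ∧
      z = M.crit G k s - x) ∨
  (M.crit G M.K s - M.zmax s < x ∧ x ≤ M.crit G M.K s - M.brkPrev M.K s ∧
      z = M.crit G M.K s - x) ∨
  (0 ≤ x ∧ x ≤ M.crit G M.K s - M.zmax s ∧ z = M.zmax s)

/-- The stationary decision rule `z*_∞`: the number singled out by `IsBaseStock` with the critical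
numbers of `g̃_∞`. -/
noncomputable def zstar (M : Model S) (x : ℝ) (s : S) : ℝ :=
  sInf {z : ℝ | M.IsBaseStock M.ginf x s z}

end Model

/-- What happens in one slot: the buffer level at its beginning, the channel condition, and the
number of packets transmitted. -/
abbrev Slot (S : Type*) : Type _ := (ℝ × S) × ℝ

/-- History-dependent randomized policies. Slots are numbered forwards by `0, 1, 2, …`. The law of
the number of packets sent in a slot may depend on the present state and on all earlier slots. -/
structure Policy (S : Type*) [MeasurableSpace S] where
  /-- decision rule of slot `0` -/
  first : Kernel (ℝ × S) ℝ
  /-- decision rule of slot `t + 1` -/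
  next : (t : ℕ) → Kernel ((Finset.Iic t → Slot S) × (ℝ × S)) ℝ
  first_markov : IsMarkovKernel first
  next_markov : ∀ t, IsMarkovKernel (next t)

attribute [instance] Policy.first_markov Policy.next_markov

namespace Policy

variable {S : Type*} [MeasurableSpace S]

/-- The deterministic stationary policy that sends `f (x, s)` packets in every slot that begins in
state `(x, s)`. -/
noncomputable def stationary (f : ℝ × S → ℝ) (hf : Measurable f) : Policy S where
  first := Kernel.deterministic f hf
  next _ := Kernel.deterministic (fun p => f p.2) (hf.comp measurable_snd)
  first_markov := inferInstance
  next_markov _ := inferInstance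

end Policy

namespace Model

variable {S : Type*} [MeasurableSpace S]

/-- The law of the next state given the history: the buffer level becomes `x + z - d`, and the
channel condition moves by its transition kernel. -/
noncomputable def nextState (M : Model S) (t : ℕ) :
    Kernel (Finset.Iic t → Slot S) (ℝ × S) :=
  (Kernel.deterministic
      (fun w : Finset.Iic t → Slot S =>
        (w ⟨t, Finset.mem_Iic.2 le_rfl⟩).1.1 + (w ⟨t, Finset.mem_Iic.2 le_rfl⟩).2 - M.d)
      (by fun_prop)) ×ₖ
    (M.kernel.comap
      (fun w : Finset.Iic t → Slot S => (w ⟨t, Finset.mem_Iic.2 le_rfl⟩).1.2) (by fun_prop))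

instance (M : Model S) (t : ℕ) : IsMarkovKernel (M.nextState t) := by
  unfold nextState; infer_instance

/-- The law of slot `t + 1` given the slots `0, …, t`, under the policy `π`. -/
noncomputable def step (M : Model S) (π : Policy S) (t : ℕ) :
    Kernel (Finset.Iic t → Slot S) (Slot S) :=
  M.nextState t ⊗ₖ π.next t

instance (M : Model S) (π : Policy S) (t : ℕ) : IsMarkovKernel (M.step π t) := by
  unfold step; infer_instance

/-- The law of the whole trajectory under the policy `π` from the initial state `(x, s)`
(Ionescu-Tulcea). -/
noncomputable def law (M : Model S) (π : Policy S) (x : ℝ) (s : S) : Measure (ℕ → Slot S) :=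
  ((π.first (x, s)).map (fun z => fun _ : Finset.Iic 0 => (((x, s), z) : Slot S))).bind
    (Kernel.traj (X := fun _ => Slot S) (M.step π) 0)

/-- `π` satisfies, from the initial state `(x, s)`, the power and the underflow constraints with
probability one in every slot. -/
def Admissible (M : Model S) (π : Policy S) (x : ℝ) (s : S) : Prop :=
  ∀ t : ℕ, ∀ᵐ ω ∂(M.law π x s),
    M.c (ω t).2 (ω t).1.2 ≤ M.P ∧ max 0 (M.d - (ω t).1.1) ≤ (ω t).2

/-- The discounted expected cost of the first `N` slots. Under the constraints all costs are
nonnegative, so that `ENNReal.ofReal` does not truncate. -/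
noncomputable def cost (M : Model S) (π : Policy S) (x : ℝ) (s : S) (N : ℕ) : ENNReal :=
  ∫⁻ ω, ∑ t ∈ Finset.range N,
    ENNReal.ofReal (M.α ^ t *
      (M.c (ω t).2 (ω t).1.2 + M.h ((ω t).1.1 + (ω t).2 - M.d))) ∂(M.law π x s)

/-- The infinite-horizon discounted expected cost, the limit of the nondecreasing sequence
`cost`. -/
noncomputable def costInf (M : Model S) (π : Policy S) (x : ℝ) (s : S) : ENNReal :=
  ⨆ N, M.cost π x s N

theorem tendsto_cost (M : Model S) (π : Policy S) (x : ℝ) (s : S) :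
    Tendsto (M.cost π x s) atTop (𝓝 (M.costInf π x s)) := by
  refine tendsto_atTop_iSup ?_
  intro m n hmn
  exact lintegral_mono fun ω =>
    Finset.sum_le_sum_of_subset (Finset.range_mono hmn)

/-- `π` solves the infinite-horizon discounted problem from every initial state. -/
def IsOptimal (M : Model S) (π : Policy S) : Prop :=
  ∀ x, 0 ≤ x → ∀ s, M.Admissible π x s ∧
    ∀ π' : Policy S, M.Admissible π' x s → M.costInf π x s ≤ M.costInf π' x s

end Model

/-! ### The power-rate curve: slopes, breakpoints and the largest feasible action. -/

namespace Model

variable {S : Type*} [MeasurableSpace S] {M : Model S}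

/-! Value iteration preserves the class `CostToGo` (`CostToGo.bellman`). The iterates start from
zero and the operator is monotone, so they increase; they stay below `bound`, so they converge. The
limit is convex, and it is lower semicontinuous at level 0 as an increasing limit of continuous
functions; this makes it continuous, hence again a member of the class. Nested compact sets of
actions allow limit and minimum to be exchanged, which gives the optimality equation
(`isLeast_Vinf`).

For convex coercive `G`, `crit G k` is the least minimizer of `G + slope k`. Pointwise convergence
alone keeps the limit of the critical numbers from falling below `crit M.ginf k`, but it could
overshoot if the limit function is flat at its minimum. The bound from above comes from comparing
horizons: lengthening the horizon makes stored packets more valuable, in that `g (n + 2) - g (n +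
1)` is nonincreasing up to level `(n + 2) d` (`V_sub_antitoneOn`, `antitoneOn_sInf_costs_sub`), and
the critical numbers of `g (n + 1)` lie in that range (`crit_g_le`). Hence they increase with `n`
and never exceed those of `ginf`.

The base-stock rule is handled through `IsThreshold`: sending beyond a point `w` of segment `k` is
worthwhile exactly if `x + w < crit G k`. This property holds in all four alternatives, determines
the action uniquely, implies optimality by subgradients, and describes the superlevel sets of
`zstar`, which gives measurability.

Optimality among all policies is a verification argument. The Bellman inequality along a feasible
trajectory bounds the cost of `m` slots below by `V m` (`Feasible.V_le`). For `zstar` the inequality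
for `Vinf` is an equality with a nonnegative remainder (`expectAt_zstar`), so its cost is at most
`Vinf`. -/

theorem brkPrev_zero (M : Model S) (s : S) : M.brkPrev 0 s = 0 := by
  simp [brkPrev]

theorem brkPrev_succ (M : Model S) (k : ℕ) (s : S) : M.brkPrev (k + 1) s = M.brk k s := by
  simp [brkPrev]

namespace Assumptions

theorem slope_le (hM : M.Assumptions) (s : S) {j k : ℕ} (hjk : j ≤ k) (hk : k ≤ M.K) :
    M.slope j s ≤ M.slope k s := by
  induction k, hjk using Nat.le_induction with
  | base => exact le_rfl
  | succ k _ ih => exact (ih (by omega)).trans (hM.slope_mono k (by omega) s)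

theorem slope_pos' (hM : M.Assumptions) (s : S) {k : ℕ} (hk : k ≤ M.K) : 0 < M.slope k s :=
  (hM.slope_pos s).trans_le (hM.slope_le s (Nat.zero_le k) hk)

theorem brkPrev_lt (hM : M.Assumptions) (s : S) {j k : ℕ} (hjk : j < k) (hk : k ≤ M.K) :
    M.brkPrev j s < M.brkPrev k s := by
  induction k, hjk using Nat.le_induction with
  | base => rw [brkPrev_succ]; exact hM.brk_lt j hk s
  | succ k _ ih =>
    refine (ih (by omega)).trans ?_
    rw [brkPrev_succ]
    exact hM.brk_lt k (by omega) s

theorem brkPrev_le (hM : M.Assumptions) (s : S) {j k : ℕ} (hjk : j ≤ k) (hk : k ≤ M.K) :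
    M.brkPrev j s ≤ M.brkPrev k s := by
  rcases hjk.eq_or_lt with rfl | h
  · exact le_rfl
  · exact (hM.brkPrev_lt s h hk).le

theorem brkPrev_nonneg (hM : M.Assumptions) (s : S) {k : ℕ} (hk : k ≤ M.K) :
    0 ≤ M.brkPrev k s := by
  rw [← M.brkPrev_zero s]
  exact hM.brkPrev_le s (Nat.zero_le k) hk

theorem brkPrev_lt_zmax (hM : M.Assumptions) (s : S) {k : ℕ} (hk : k ≤ M.K) :
    M.brkPrev k s < M.zmax s :=
  (hM.brkPrev_le s hk le_rfl).trans_lt (hM.brk_lt_zmax s)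

/-- On segment `k`, the slope `slope k s` is a subgradient of the power-rate curve. -/
theorem c_subgradient (hM : M.Assumptions) {s : S} {k : ℕ} (hk : k ≤ M.K) {z : ℝ}
    (h1 : M.brkPrev k s ≤ z) (h2 : k < M.K → z ≤ M.brk k s) (z' : ℝ) :
    M.c z s + M.slope k s * (z' - z) ≤ M.c z' s := by
  -- The slope telescopes into the contributions of the hinges with index below `k`, so that the
  -- inequality can be checked hinge by hinge.
  have hslope : M.slope k s = M.slope 0 s +
      ∑ j ∈ Finset.range M.K, (M.slope (j + 1) s - M.slope j s) * (if j < k then 1 else 0) := by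
    have : ∑ j ∈ Finset.range M.K, (M.slope (j + 1) s - M.slope j s) * (if j < k then (1 : ℝ) else 0)
        = ∑ j ∈ Finset.range k, (M.slope (j + 1) s - M.slope j s) := by
      simp only [mul_ite, mul_one, mul_zero]
      rw [← Finset.sum_filter]
      congr 1
      ext j
      simp only [Finset.mem_filter, Finset.mem_range]
      omega
    rw [this, Finset.sum_range_sub (fun j => M.slope j s)]
    ring
  have key : ∀ j ∈ Finset.range M.K,
      (M.slope (j + 1) s - M.slope j s) * max (z - M.brk j s) 0 +
        (M.slope (j + 1) s - M.slope j s) * (if j < k then 1 else 0) * (z' - z) ≤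
      (M.slope (j + 1) s - M.slope j s) * max (z' - M.brk j s) 0 := by
    intro j hj
    rw [Finset.mem_range] at hj
    have hc : 0 ≤ M.slope (j + 1) s - M.slope j s := sub_nonneg.2 (hM.slope_mono j hj s)
    rw [mul_assoc, ← mul_add]
    refine mul_le_mul_of_nonneg_left ?_ hc
    by_cases hjk : j < k
    · have : M.brk j s ≤ z := by
        rw [← brkPrev_succ]
        exact (hM.brkPrev_le s hjk hk).trans h1
      rw [if_pos hjk, max_eq_left (by linarith)]
      exact le_trans (by linarith) (le_max_left _ _)
    · have : z ≤ M.brk j s := by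
        have hkK : k < M.K := by omega
        refine (h2 hkK).trans ?_
        rw [← brkPrev_succ, ← brkPrev_succ]
        exact hM.brkPrev_le s (by omega) (by omega)
      rw [if_neg hjk, max_eq_right (by linarith)]
      exact le_trans (by linarith) (le_max_right _ _)
  have hsum := Finset.sum_le_sum key
  rw [Finset.sum_add_distrib, ← Finset.sum_mul] at hsum
  unfold c
  rw [hslope]
  linarith

theorem c_zero (hM : M.Assumptions) (s : S) : M.c 0 s = 0 := by
  unfold c
  rw [zero_mul, zero_add]
  refine Finset.sum_eq_zero fun j hj => ?_
  rw [Finset.mem_range] at hj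
  have h0 : 0 ≤ M.brk j s := by
    rw [← brkPrev_succ]
    exact hM.brkPrev_nonneg s hj
  rw [max_eq_right (by linarith), mul_zero]

theorem c_strictMono (hM : M.Assumptions) (s : S) : StrictMono fun z => M.c z s := by
  intro z z' h
  unfold c
  refine add_lt_add_of_lt_of_le (mul_lt_mul_of_pos_right h (hM.slope_pos s)) ?_
  refine Finset.sum_le_sum fun j hj => ?_
  rw [Finset.mem_range] at hj
  exact mul_le_mul_of_nonneg_left (max_le_max (by linarith) le_rfl)
    (sub_nonneg.2 (hM.slope_mono j hj s))

theorem c_nonneg (hM : M.Assumptions) (s : S) {z : ℝ} (hz : 0 ≤ z) : 0 ≤ M.c z s := by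
  rw [← hM.c_zero s]
  exact (hM.c_strictMono s).monotone hz

theorem c_convexOn (hM : M.Assumptions) (s : S) : ConvexOn ℝ Set.univ fun z => M.c z s := by
  have hlin : ∀ a b : ℝ, ConvexOn ℝ Set.univ fun z : ℝ => z * a - b := by
    intro a b
    refine ⟨convex_univ, fun x _ y _ u v _ _ huv => le_of_eq ?_⟩
    simp only [smul_eq_mul]
    linear_combination b * huv
  unfold c
  refine ConvexOn.add (by simpa using hlin (M.slope 0 s) 0) ?_
  have hsum : ∀ n ≤ M.K, ConvexOn ℝ Set.univ fun z =>
      ∑ j ∈ Finset.range n, (M.slope (j + 1) s - M.slope j s) * max (z - M.brk j s) 0 := by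
    intro n
    induction n with
    | zero => intro _; simpa using convexOn_const (0 : ℝ) convex_univ
    | succ n ih =>
      intro hn
      simp only [Finset.sum_range_succ]
      refine (ih (by omega)).add ?_
      have := ((hlin 1 (M.brk n s)).sup (convexOn_const (0 : ℝ) convex_univ)).smul
        (sub_nonneg.2 (hM.slope_mono n (by omega) s))
      simpa using this
  exact hsum M.K le_rfl

theorem c_zmax (hM : M.Assumptions) (s : S) : M.c (M.zmax s) s = M.P := by
  -- Solvability of `c z s = P` is encoded in `d ≤ zmax`: without a solution, `zmax` would be the
  -- default value `sInf ∅ = 0 < d`.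
  rcases Set.eq_empty_or_nonempty {z : ℝ | M.c z s = M.P} with h | ⟨z, hz⟩
  · have h1 := hM.d_le_zmax s
    have h2 := hM.d_pos
    rw [zmax, h, Real.sInf_empty] at h1
    linarith
  · change M.c z s = M.P at hz
    have : {z : ℝ | M.c z s = M.P} = {z} := by
      ext w
      exact ⟨fun h => (hM.c_strictMono s).injective (Eq.trans h hz.symm), fun h => h ▸ hz⟩
    rw [zmax, this, csInf_singleton]
    exact hz

theorem c_le_iff (hM : M.Assumptions) (s : S) (z : ℝ) : M.c z s ≤ M.P ↔ z ≤ M.zmax s := by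
  rw [← hM.c_zmax s]
  exact (hM.c_strictMono s).le_iff_le

theorem zmax_pos (hM : M.Assumptions) (s : S) : 0 < M.zmax s :=
  hM.d_pos.trans_le (hM.d_le_zmax s)

theorem measurable_c (hM : M.Assumptions) : Measurable fun p : ℝ × S => M.c p.1 p.2 := by
  unfold c
  have h0 := hM.slope_meas 0 (Nat.zero_le _)
  refine (measurable_fst.mul (h0.comp measurable_snd)).add ?_
  refine Finset.measurable_fun_sum _ fun j hj => ?_
  rw [Finset.mem_range] at hj
  have h1 := hM.slope_meas (j + 1) (by omega)
  have h2 := hM.slope_meas j hj.le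
  have h3 := hM.brk_meas j hj
  exact ((h1.comp measurable_snd).sub (h2.comp measurable_snd)).mul
    ((measurable_fst.sub (h3.comp measurable_snd)).max measurable_const)

theorem measurable_zmax (hM : M.Assumptions) : Measurable M.zmax := by
  refine measurable_of_Ici fun z => ?_
  have : M.zmax ⁻¹' Set.Ici z = {s | M.c z s ≤ M.P} := by
    ext s
    exact (hM.c_le_iff s z).symm
  rw [this]
  exact measurableSet_le (hM.measurable_c.comp measurable_prodMk_left) measurable_const

theorem measurable_brkPrev (hM : M.Assumptions) {k : ℕ} (hk : k ≤ M.K) :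
    Measurable (M.brkPrev k) := by
  cases k with
  | zero => simpa only [funext M.brkPrev_zero] using measurable_const
  | succ k => simpa only [funext (M.brkPrev_succ k)] using hM.brk_meas k hk

end Assumptions

theorem continuous_c (M : Model S) (s : S) : Continuous fun z => M.c z s := by
  unfold c
  fun_prop

theorem mem_actions {x z : ℝ} {s : S} :
    z ∈ M.actions x s ↔ 0 ≤ z ∧ M.d ≤ x + z ∧ z ≤ M.zmax s := by
  rw [actions, Set.mem_ofPred_eq, max_le_iff, and_assoc]
  exact and_congr_right fun _ => and_congr_left fun _ => by rw [sub_le_iff_le_add, add_comm]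

end Model

/-! ### Convex functions on a ray. -/

/-- A convex function on a ray that is bounded below by a line through its value at the left end of
a subray has there a right derivative that is at least the slope of the line. -/
theorem ConvexOn.exists_hasDerivWithinAt_Ioi_iff {d b a : ℝ} {f : ℝ → ℝ}
    (hf : ConvexOn ℝ (Set.Ici d) f) (hb : d ≤ b) :
    (∃ L : ℝ, HasDerivWithinAt f L (Set.Ioi b) b ∧ -a ≤ L) ↔
      ∀ y, b ≤ y → f b + a * b ≤ f y + a * y := by
  constructor
  · rintro ⟨L, hL, haL⟩ y hy
    rcases hy.eq_or_lt with rfl | hy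
    · exact le_rfl
    have h := haL.trans (hf.le_slope_of_hasDerivWithinAt_Ioi hb (hb.trans hy.le) hy hL)
    rw [slope_def_field, le_div_iff₀ (sub_pos.2 hy)] at h
    linarith
  · intro h
    have hbound : ∀ y, b < y → -a ≤ slope f b y := by
      intro y hy
      rw [slope_def_field, le_div_iff₀ (sub_pos.2 hy)]
      linarith [h y hy.le]
    have hmono : MonotoneOn (slope f b) (Set.Ioi b) := by
      intro y hy z hz hyz
      simp_rw [slope_def_field]
      exact hf.secant_mono hb (hb.trans (le_of_lt hy)) (hb.trans (le_of_lt hz)) (ne_of_gt hy)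
        (ne_of_gt hz) hyz
    have hbdd : BddBelow (slope f b '' Set.Ioi b) := by
      refine ⟨-a, ?_⟩
      rintro _ ⟨y, hy, rfl⟩
      exact hbound y hy
    -- Secant slopes decrease as `y` decreases to `b`; being bounded below by `-a`, they converge to
    -- their infimum, so the right derivative is finite even at `b = d`.
    refine ⟨sInf (slope f b '' Set.Ioi b), ?_, ?_⟩
    · rw [hasDerivWithinAt_iff_tendsto_slope' Set.self_notMem_Ioi]
      exact hmono.tendsto_nhdsGT hbdd
    · refine le_csInf (Set.nonempty_Ioi.image _) ?_
      rintro _ ⟨y, hy, rfl⟩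
      exact hbound y hy

/-- A finite convex function on a ray is continuous there as soon as it is lower semicontinuous at
the end of the ray. -/
theorem ConvexOn.continuousOn_Ici_of_lowerSemicontinuousWithinAt {d : ℝ} {f : ℝ → ℝ}
    (hf : ConvexOn ℝ (Set.Ici d) f)
    (hlsc : LowerSemicontinuousWithinAt f (Set.Ici d) d) : ContinuousOn f (Set.Ici d) := by
  refine hf.continuousOn_Ici ?_
  refine tendsto_order.2 ⟨fun r hr => hlsc r hr, fun r hr => ?_⟩
  -- Upper semicontinuity at `d` is automatic: the chord over `[d, d + 1]` lies above `f` and tends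
  -- to `f d`.
  have hcont : Continuous fun y => f d + (y - d) * (f (d + 1) - f d) := by fun_prop
  have h1 : Tendsto (fun y => f d + (y - d) * (f (d + 1) - f d)) (𝓝[Set.Ici d] d) (𝓝 (f d)) := by
    have := hcont.tendsto d
    simp only [sub_self, zero_mul, add_zero] at this
    exact this.mono_left nhdsWithin_le_nhds
  filter_upwards [h1.eventually_lt_const hr, self_mem_nhdsWithin,
    nhdsWithin_le_nhds (Iio_mem_nhds (lt_add_one d))] with y hy hdy hy1
  refine lt_of_le_of_lt ?_ hy
  have hdy : d ≤ y := hdy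
  have hy1 : y < d + 1 := hy1
  have h := hf.2 (Set.self_mem_Ici (a := d)) (show d + 1 ∈ Set.Ici d by simp)
    (show 0 ≤ 1 - (y - d) by linarith) (show 0 ≤ y - d by linarith) (by ring)
  simp only [smul_eq_mul] at h
  rw [show (1 - (y - d)) * d + (y - d) * (d + 1) = y by ring] at h
  linarith

/-- Convex functions on the ray `[d, ∞)` that are continuous and tend to infinity. -/
structure CoerciveConvexOn (d : ℝ) (f : ℝ → ℝ) : Prop where
  convex : ConvexOn ℝ (Set.Ici d) f
  cont : ContinuousOn f (Set.Ici d)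
  tendsto : Tendsto f atTop atTop

namespace CoerciveConvexOn

variable {d a : ℝ} {f : ℝ → ℝ}

theorem exists_isMinOn (hf : CoerciveConvexOn d f) (ha : 0 ≤ a) :
    ∃ m, d ≤ m ∧ ∀ y, d ≤ y → f m + a * m ≤ f y + a * y := by
  have hev : ∀ᶠ y in atTop, f d + a * d ≤ f y + a * y := by
    filter_upwards [hf.tendsto.eventually_ge_atTop (f d), eventually_ge_atTop d] with y h1 h2
    have := mul_le_mul_of_nonneg_left h2 ha
    linarith
  obtain ⟨T, hT⟩ := eventually_atTop.1 hev
  have hcont : ContinuousOn (fun y => f y + a * y) (Set.Icc d (max d T)) :=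
    (hf.cont.mono Set.Icc_subset_Ici_self).add (by fun_prop)
  obtain ⟨m, hm, hmin⟩ := isCompact_Icc.exists_isMinOn
    (Set.nonempty_Icc.2 (le_max_left d T)) hcont
  refine ⟨m, hm.1, fun y hy => ?_⟩
  by_cases hyT : y ≤ max d T
  · exact hmin ⟨hy, hyT⟩
  · exact (hmin ⟨le_rfl, le_max_left d T⟩).trans
      (hT y ((le_max_right d T).trans (not_le.1 hyT).le))

end CoerciveConvexOn

/-! ### Critical numbers as least minimizers. -/

namespace Model

variable {S : Type*} [MeasurableSpace S] {M : Model S} {G G' : ℝ → S → ℝ} {k : ℕ} {s : S}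

/-- Trades the derivative for inequalities between values, which survive pointwise limits;
derivatives play no role from here on. -/
theorem crit_eq_max_sInf (hG : ConvexOn ℝ (Set.Ici M.d) fun y => G y s) :
    M.crit G k s = max M.d (sInf {b : ℝ | M.d ≤ b ∧
      ∀ y, b ≤ y → G b s + M.slope k s * b ≤ G y s + M.slope k s * y}) := by
  unfold crit
  congr 2
  ext b
  exact and_congr_right fun hb => hG.exists_hasDerivWithinAt_Ioi_iff hb

theorem d_le_crit (M : Model S) (G : ℝ → S → ℝ) (k : ℕ) (s : S) : M.d ≤ M.crit G k s :=
  le_max_left _ _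

/-- A point to the right of which `G + slope k` is nowhere smaller is at least `crit G k`. -/
theorem crit_le (hG : ConvexOn ℝ (Set.Ici M.d) fun y => G y s) {b : ℝ} (hb : M.d ≤ b)
    (h : ∀ y, b ≤ y → G b s + M.slope k s * b ≤ G y s + M.slope k s * y) :
    M.crit G k s ≤ b := by
  rw [crit_eq_max_sInf hG]
  exact max_le hb (csInf_le ⟨M.d, fun _ h => h.1⟩ ⟨hb, h⟩)

/-- `crit G k` minimizes `G + slope k`. -/
theorem crit_isMin (hG : CoerciveConvexOn M.d fun y => G y s) (hk : 0 ≤ M.slope k s) {y : ℝ}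
    (hy : M.d ≤ y) :
    G (M.crit G k s) s + M.slope k s * M.crit G k s ≤ G y s + M.slope k s * y := by
  set A := {b : ℝ | M.d ≤ b ∧
    ∀ y, b ≤ y → G b s + M.slope k s * b ≤ G y s + M.slope k s * y} with hA
  obtain ⟨m, hdm, hm⟩ := hG.exists_isMinOn hk
  have hmA : m ∈ A := ⟨hdm, fun y hy => hm y (hdm.trans hy)⟩
  have hbdd : BddBelow A := ⟨M.d, fun _ h => h.1⟩
  -- A minimizer exists, so `A` is a nonempty set of points `≥ d`; neither the default value of
  -- `sInf` nor the outer `max` intervenes.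
  have hcrit : M.crit G k s = sInf A := by
    rw [crit_eq_max_sInf hG.convex]
    exact max_eq_right (le_csInf ⟨m, hmA⟩ fun _ h => h.1)
  have hdc : M.d ≤ sInf A := le_csInf ⟨m, hmA⟩ fun _ h => h.1
  have hcl : sInf A ∈ closure A := csInf_mem_closure ⟨m, hmA⟩ hbdd
  have hne : (𝓝[A] (sInf A)).NeBot := mem_closure_iff_nhdsWithin_neBot.1 hcl
  have hcont : Tendsto (fun b => G b s + M.slope k s * b) (𝓝[A] (sInf A))
      (𝓝 (G (sInf A) s + M.slope k s * sInf A)) := by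
    refine Tendsto.add ?_ ?_
    · exact (hG.cont (sInf A) hdc).mono_left (nhdsWithin_mono _ fun b hb => hb.1)
    · exact ((continuous_const.mul continuous_id).tendsto _).mono_left nhdsWithin_le_nhds
  rw [hcrit]
  refine le_trans ?_ (hm y hy)
  -- If the infimum is below the minimizer `m`, points of `A` near it lie to the left of `m` and are
  -- no worse than `m`; continuity carries this to the infimum.
  rcases (csInf_le hbdd hmA).eq_or_lt with h | h
  · rw [h]
  · refine le_of_tendsto hcont ?_
    filter_upwards [self_mem_nhdsWithin, nhdsWithin_le_nhds (Iio_mem_nhds h)] with b hb hbm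
    exact hb.2 m (le_of_lt hbm)

/-- `crit G k` is the least minimizer of `G + slope k`. -/
theorem lt_of_lt_crit (hG : CoerciveConvexOn M.d fun y => G y s) (hk : 0 ≤ M.slope k s) {y : ℝ}
    (hy : M.d ≤ y) (hyc : y < M.crit G k s) :
    G (M.crit G k s) s + M.slope k s * M.crit G k s < G y s + M.slope k s * y := by
  by_contra! h
  exact absurd (crit_le hG.convex hy fun y' hy' =>
    h.trans (crit_isMin hG hk (hy.trans hy'))) (not_le.2 hyc)

theorem convexOn_add_slope (hG : ConvexOn ℝ (Set.Ici M.d) fun y => G y s) (a : ℝ) :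
    ConvexOn ℝ (Set.Ici M.d) fun y => G y s + a * y := by
  refine hG.add ⟨convex_Ici _, fun x _ y _ u v _ _ _ => le_of_eq ?_⟩
  simp only [smul_eq_mul]
  ring

/-- To the right of `crit G k`, the function `G + slope k` is nondecreasing. -/
theorem add_slope_le_of_crit_le (hG : CoerciveConvexOn M.d fun y => G y s)
    (hk : 0 ≤ M.slope k s) {y y' : ℝ} (h1 : M.crit G k s ≤ y) (h2 : y ≤ y') :
    G y s + M.slope k s * y ≤ G y' s + M.slope k s * y' := by
  have hd := M.d_le_crit G k s
  have hd' := hd.trans (h1.trans h2)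
  have := (convexOn_add_slope hG.convex (M.slope k s)).le_max_of_mem_Icc hd hd' ⟨h1, h2⟩
  exact this.trans (max_le (crit_isMin hG hk hd') le_rfl)

/-- To the left of `crit G k`, the function `G + slope k` is nonincreasing. -/
theorem add_slope_le_of_le_crit (hG : CoerciveConvexOn M.d fun y => G y s)
    (hk : 0 ≤ M.slope k s) {y y' : ℝ} (hy : M.d ≤ y) (h1 : y ≤ y') (h2 : y' ≤ M.crit G k s) :
    G y' s + M.slope k s * y' ≤ G y s + M.slope k s * y := by
  have hd := M.d_le_crit G k s
  have := (convexOn_add_slope hG.convex (M.slope k s)).le_max_of_mem_Icc hy hd ⟨h1, h2⟩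
  exact this.trans (max_le le_rfl (crit_isMin hG hk hy))

/-- The tilts differ by a nondecreasing linear function, so the tilt with the larger slope cannot
fall below its value at `crit G j` further to the right. -/
theorem crit_antitone (hG : CoerciveConvexOn M.d fun y => G y s) {j k : ℕ}
    (hj : 0 ≤ M.slope j s) (hjk : M.slope j s ≤ M.slope k s) :
    M.crit G k s ≤ M.crit G j s := by
  refine crit_le hG.convex (M.d_le_crit G j s) fun y hy => ?_
  have h1 := crit_isMin hG hj ((M.d_le_crit G j s).trans hy)
  have h2 := mul_le_mul_of_nonneg_left hy (sub_nonneg.2 hjk)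
  linarith

/-- Measurability of the critical numbers. -/
theorem measurable_crit (hG : ∀ s, CoerciveConvexOn M.d fun y => G y s)
    (hmeas : ∀ y, M.d ≤ y → Measurable (G y)) (hk : ∀ s, 0 ≤ M.slope k s)
    (hslope : Measurable (M.slope k)) : Measurable (M.crit G k) := by
  refine measurable_of_Iio fun b => ?_
  -- The tilted function is nondecreasing beyond `crit G k`, so a rational `q` between `crit G k`
  -- and `b` serves as a witness; by continuity it need only be tested against rational `r`.
  have hset : M.crit G k ⁻¹' Set.Iio b =
      ⋃ q : ℚ, ⋃ (_ : M.d ≤ q ∧ (q : ℝ) < b), ⋂ r : ℚ, ⋂ (_ : (q : ℝ) ≤ r),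
        {s | G q s + M.slope k s * q ≤ G r s + M.slope k s * r} := by
    ext s
    simp only [Set.mem_preimage, Set.mem_Iio, Set.mem_iUnion, Set.mem_iInter, Set.mem_ofPred_eq,
      exists_prop]
    constructor
    · intro h
      obtain ⟨q, h1, h2⟩ := exists_rat_btwn h
      exact ⟨q, ⟨(M.d_le_crit G k s).trans h1.le, h2⟩, fun r hr =>
        add_slope_le_of_crit_le (hG s) (hk s) h1.le hr⟩
    · rintro ⟨q, ⟨h1, h2⟩, h⟩
      refine lt_of_le_of_lt (crit_le (hG s).convex h1 fun y hy => ?_) h2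
      rcases hy.eq_or_lt with rfl | hy
      · exact le_rfl
      have hcont : ContinuousAt (fun y => G y s + M.slope k s * y) y :=
        (((hG s).cont.add (by fun_prop : ContinuousOn (fun y => M.slope k s * y) _)).continuousAt
          (Ici_mem_nhds (h1.trans_lt hy)))
      by_contra! hlt
      have hev := (hcont.eventually_lt_const hlt).and (lt_mem_nhds hy)
      obtain ⟨r, hr⟩ := Rat.denseRange_cast.exists_mem_open isOpen_interior
        ⟨y, mem_interior_iff_mem_nhds.2 hev⟩
      obtain ⟨h3, h4⟩ := interior_subset hr
      exact absurd (h r (le_of_lt h4)) (not_le.2 h3)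
  rw [hset]
  refine MeasurableSet.iUnion fun q => MeasurableSet.iUnion fun hq => MeasurableSet.iInter fun r =>
    MeasurableSet.iInter fun hr => ?_
  exact measurableSet_le ((hmeas q hq.1).add (hslope.mul_const _))
    ((hmeas r (hq.1.trans hr)).add (hslope.mul_const _))

end Model

/-! ### The dynamic programming operator and the class it preserves. -/

namespace Model

variable {S : Type*} [MeasurableSpace S] {M : Model S} {W W' G G' : ℝ → S → ℝ}

namespace Assumptions

/-- Convexity leaves open only a jump at the endpoint, which `h 0 = 0 ≤ h` excludes. -/
theorem continuousOn_h (hM : M.Assumptions) : ContinuousOn M.h (Set.Ici 0) := by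
  refine hM.h_convex.continuousOn_Ici_of_lowerSemicontinuousWithinAt fun r hr => ?_
  filter_upwards [self_mem_nhdsWithin] with x hx
  exact (hM.h_zero ▸ show r < M.h 0 from hr : r < 0).trans_le (hM.h_nonneg x hx)

theorem P_nonneg (hM : M.Assumptions) (s : S) : 0 ≤ M.P := by
  rw [← hM.c_zmax s]
  exact hM.c_nonneg s (hM.zmax_pos s).le

theorem d_mem_actions (hM : M.Assumptions) {x : ℝ} (hx : 0 ≤ x) (s : S) :
    M.d ∈ M.actions x s :=
  mem_actions.2 ⟨hM.d_pos.le, by linarith, hM.d_le_zmax s⟩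

theorem convexOn_h_sub (hM : M.Assumptions) :
    ConvexOn ℝ (Set.Ici M.d) fun y => M.h (y - M.d) := by
  refine ⟨convex_Ici _, fun x hx y hy a b ha hb hab => ?_⟩
  have hx' : M.d ≤ x := hx
  have hy' : M.d ≤ y := hy
  have := hM.h_convex.2 (show x - M.d ∈ Set.Ici 0 from sub_nonneg.2 hx')
    (show y - M.d ∈ Set.Ici 0 from sub_nonneg.2 hy') ha hb hab
  simp only [smul_eq_mul] at this ⊢
  convert this using 2
  linear_combination M.d * hab

end Assumptions

/-- An upper bound for the cost-to-go at buffer level `x`: the cost of a policy that keeps the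
buffer level constant. -/
noncomputable def bound (M : Model S) (x : ℝ) : ℝ := (M.P + M.h x) / (1 - M.α)

theorem Assumptions.bound_mono (hM : M.Assumptions) {x y : ℝ} (hx : 0 ≤ x)
    (hxy : x ≤ y) : M.bound x ≤ M.bound y := by
  have h1 := hM.α_lt_one
  exact div_le_div_of_nonneg_right
    (by linarith [hM.h_mono (show x ∈ Set.Ici 0 from hx) (hx.trans hxy) hxy]) (by linarith)

theorem Assumptions.bound_eq (hM : M.Assumptions) (x : ℝ) :
    M.P + M.h x + M.α * M.bound x = M.bound x := by
  have h1 : (1 - M.α) ≠ 0 := by linarith [hM.α_lt_one]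
  unfold bound
  field_simp
  ring

/-- The properties of a cost-to-go that dynamic programming preserves. -/
structure CostToGo (M : Model S) (W : ℝ → S → ℝ) : Prop where
  nonneg : ∀ x, 0 ≤ x → ∀ s, 0 ≤ W x s
  le_bound : ∀ x, 0 ≤ x → ∀ s, W x s ≤ M.bound x
  convex : ∀ s, ConvexOn ℝ (Set.Ici 0) fun x => W x s
  cont : ∀ s, ContinuousOn (fun x => W x s) (Set.Ici 0)
  meas : ∀ x, 0 ≤ x → Measurable (W x)

namespace CostToGo

theorem integrable (hW : M.CostToGo W) {x : ℝ} (hx : 0 ≤ x) (s : S) :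
    Integrable (fun s' => W x s') (M.kernel s) := by
  refine Integrable.of_bound (hW.meas x hx).aestronglyMeasurable (M.bound x) (ae_of_all _ ?_)
  intro s'
  rw [Real.norm_eq_abs, abs_of_nonneg (hW.nonneg x hx s')]
  exact hW.le_bound x hx s'

/-- Continuity in one variable and measurability in the other give joint measurability; the clamp at
0 is there because nothing is known about negative levels. -/
theorem measurable_uncurry (hW : M.CostToGo W) :
    Measurable fun p : ℝ × S => W (max p.1 0) p.2 := by
  refine measurable_uncurry_of_continuous_of_measurable (u := fun x s => W (max x 0) s) ?_ ?_
  · intro s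
    exact (hW.cont s).comp_continuous (by fun_prop) fun x => le_max_right x 0
  · intro x
    exact hW.meas _ (le_max_right x 0)

theorem h_le_after (hM : M.Assumptions) (hW : M.CostToGo W) {y : ℝ} (hy : M.d ≤ y) (s : S) :
    M.h (y - M.d) ≤ M.after W y s := by
  unfold after
  have : 0 ≤ ∫ s', W (y - M.d) s' ∂(M.kernel s) :=
    integral_nonneg fun s' => hW.nonneg (y - M.d) (sub_nonneg.2 hy) s'
  linarith [mul_nonneg hM.α_nonneg this]

theorem after_nonneg (hM : M.Assumptions) (hW : M.CostToGo W) {y : ℝ} (hy : M.d ≤ y) (s : S) :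
    0 ≤ M.after W y s :=
  (hM.h_nonneg _ (sub_nonneg.2 hy)).trans (hW.h_le_after hM hy s)

theorem after_le (hM : M.Assumptions) (hW : M.CostToGo W) {y : ℝ} (hy : M.d ≤ y) (s : S) :
    M.after W y s ≤ M.h (y - M.d) + M.α * M.bound (y - M.d) := by
  unfold after
  have hy' := sub_nonneg.2 hy
  have : ∫ s', W (y - M.d) s' ∂(M.kernel s) ≤ M.bound (y - M.d) := by
    refine (integral_mono (hW.integrable hy' s) (integrable_const _)
      fun s' => hW.le_bound _ hy' s').trans ?_
    simp
  linarith [mul_le_mul_of_nonneg_left this hM.α_nonneg]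

theorem after_mono (hM : M.Assumptions) (hW : M.CostToGo W) (hW' : M.CostToGo W')
    (h : ∀ x, 0 ≤ x → ∀ s, W x s ≤ W' x s) {y : ℝ} (hy : M.d ≤ y) (s : S) :
    M.after W y s ≤ M.after W' y s := by
  have hy' := sub_nonneg.2 hy
  unfold after
  have := integral_mono (hW.integrable hy' s) (hW'.integrable hy' s) fun s' => h _ hy' s'
  linarith [mul_le_mul_of_nonneg_left this hM.α_nonneg]

theorem after_convexOn (hM : M.Assumptions) (hW : M.CostToGo W) (s : S) :
    ConvexOn ℝ (Set.Ici M.d) fun y => M.after W y s := by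
  unfold after
  refine hM.convexOn_h_sub.add ⟨convex_Ici _, fun x hx y hy a b ha hb hab => ?_⟩
  have hx' : 0 ≤ x - M.d := sub_nonneg.2 hx
  have hy' : 0 ≤ y - M.d := sub_nonneg.2 hy
  have hz : a * x + b * y - M.d = a * (x - M.d) + b * (y - M.d) := by
    linear_combination M.d * hab
  have hz' : 0 ≤ a * x + b * y - M.d := by rw [hz]; positivity
  simp only [smul_eq_mul]
  have hint : ∫ s', W (a * x + b * y - M.d) s' ∂(M.kernel s) ≤
      a * ∫ s', W (x - M.d) s' ∂(M.kernel s) + b * ∫ s', W (y - M.d) s' ∂(M.kernel s) := by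
    rw [← integral_const_mul, ← integral_const_mul, ← integral_add
      ((hW.integrable hx' s).const_mul a) ((hW.integrable hy' s).const_mul b)]
    refine integral_mono (hW.integrable hz' s)
      (((hW.integrable hx' s).const_mul a).add ((hW.integrable hy' s).const_mul b)) fun s' => ?_
    have := (hW.convex s').2 hx' hy' ha hb hab
    simp only [smul_eq_mul] at this
    rw [← hz] at this
    exact this
  calc _ ≤ M.α * (a * ∫ s', W (x - M.d) s' ∂(M.kernel s) +
        b * ∫ s', W (y - M.d) s' ∂(M.kernel s)) := mul_le_mul_of_nonneg_left hint hM.α_nonneg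
    _ = _ := by ring

theorem after_continuousOn (hM : M.Assumptions) (hW : M.CostToGo W) (s : S) :
    ContinuousOn (fun y => M.after W y s) (Set.Ici M.d) := by
  have hmaps : Set.MapsTo (fun y => y - M.d) (Set.Ici M.d) (Set.Ici 0) :=
    fun y hy => Set.mem_Ici.2 (sub_nonneg.2 hy)
  have hcont : ContinuousOn (fun y => y - M.d) (Set.Ici M.d) := by fun_prop
  unfold after
  refine (hM.continuousOn_h.comp hcont hmaps).add (continuousOn_const.mul ?_)
  intro y hy
  -- `bound` does not depend on the channel condition and is monotone, so its value one unit to the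
  -- right dominates near `y`.
  refine tendsto_integral_filter_of_dominated_convergence (fun _ => M.bound (y + 1 - M.d))
    ?_ ?_ (integrable_const _) ?_
  · filter_upwards [self_mem_nhdsWithin] with y' hy'
    exact (hW.meas _ (hmaps hy')).aestronglyMeasurable
  · filter_upwards [self_mem_nhdsWithin, nhdsWithin_le_nhds (Iio_mem_nhds (lt_add_one y))]
      with y' hy' hlt
    have hlt : y' < y + 1 := hlt
    refine ae_of_all _ fun s' => ?_
    rw [Real.norm_eq_abs, abs_of_nonneg (hW.nonneg _ (hmaps hy') s')]
    exact (hW.le_bound _ (hmaps hy') s').trans (hM.bound_mono (hmaps hy') (by linarith))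
  · exact ae_of_all _ fun s' => ((hW.cont s').comp hcont hmaps) y hy

theorem after_tendsto (hM : M.Assumptions) (hW : M.CostToGo W) (s : S) :
    Tendsto (fun y => M.after W y s) atTop atTop := by
  refine tendsto_atTop_mono' _ ?_ (hM.h_tendsto.comp (tendsto_atTop_add_const_right _ (-M.d)
    tendsto_id))
  filter_upwards [eventually_ge_atTop M.d] with y hy
  exact hW.h_le_after hM hy s

theorem after_coercive (hM : M.Assumptions) (hW : M.CostToGo W) (s : S) :
    CoerciveConvexOn M.d fun y => M.after W y s :=
  ⟨hW.after_convexOn hM s, hW.after_continuousOn hM s, hW.after_tendsto hM s⟩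

theorem after_measurable (hW : M.CostToGo W) {y : ℝ} (hy : M.d ≤ y) :
    Measurable (M.after W y) := by
  unfold after
  exact measurable_const.add (((hW.meas _ (sub_nonneg.2 hy)).stronglyMeasurable.integral_kernel
    (κ := M.kernel)).measurable.const_mul _)

end CostToGo

/-- The objective minimized by the scheduler when `G` is the cost as a function of the buffer level
after transmission; the action is parametrized by `r ↦ max (d - x) r`. -/
noncomputable def objective (M : Model S) (G : ℝ → S → ℝ) (x r : ℝ) (s : S) : ℝ :=
  M.c (max (M.d - x) r) s + G (max M.d (x + r)) s

/-- The set of costs of the feasible actions. -/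
def costs (M : Model S) (G : ℝ → S → ℝ) (x : ℝ) (s : S) : Set ℝ :=
  (fun z => M.c z s + G (x + z) s) '' M.actions x s

/-- Moves the underflow constraint into the objective, so that the minimum runs over a compact
interval that does not depend on `x`; the clamps also keep `G` on its domain. -/
theorem costs_eq_image (hM : M.Assumptions) (G : ℝ → S → ℝ) {x : ℝ} (hx : 0 ≤ x) (s : S) :
    M.costs G x s = (fun r => M.objective G x r s) '' Set.Icc 0 (M.zmax s) := by
  have hd := hM.d_le_zmax s
  ext v
  constructor
  · rintro ⟨z, hz, rfl⟩
    rw [mem_actions] at hz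
    refine ⟨z, ⟨hz.1, hz.2.2⟩, ?_⟩
    simp only [objective]
    rw [max_eq_right (by linarith), max_eq_right hz.2.1]
  · rintro ⟨r, hr, rfl⟩
    refine ⟨max (M.d - x) r, mem_actions.2 ⟨le_max_of_le_right hr.1, ?_, max_le (by linarith) hr.2⟩,
      ?_⟩
    · linarith [le_max_left (M.d - x) r]
    · simp only [objective]
      rw [← max_add_add_left, add_sub_cancel]

theorem continuous_objective (hG : ∀ s, ContinuousOn (fun y => G y s) (Set.Ici M.d)) (s : S) :
    Continuous fun p : ℝ × ℝ => M.objective G p.1 p.2 s := by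
  unfold objective
  refine ((M.continuous_c s).comp (by fun_prop)).add ?_
  exact (hG s).comp_continuous (by fun_prop) fun p => Set.mem_Ici.2 (le_max_left _ _)

theorem measurable_objective (hM : M.Assumptions)
    (hG : ∀ s, ContinuousOn (fun y => G y s) (Set.Ici M.d))
    (hmeas : ∀ y, M.d ≤ y → Measurable (G y)) (x : ℝ) :
    Measurable fun p : ℝ × S => M.objective G x p.1 p.2 := by
  unfold objective
  have h1 : Measurable fun p : ℝ × S => G (max M.d p.1) p.2 := by
    refine measurable_uncurry_of_continuous_of_measurable (u := fun y s => G (max M.d y) s) ?_ ?_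
    · intro s
      exact (hG s).comp_continuous (by fun_prop) fun y => Set.mem_Ici.2 (le_max_left _ _)
    · intro y
      exact hmeas _ (le_max_left _ _)
  exact (hM.measurable_c.comp ((measurable_const.max measurable_fst).prodMk measurable_snd)).add
    (h1.comp ((measurable_const.add measurable_fst).prodMk measurable_snd))

theorem isLeast_sInf_costs (hM : M.Assumptions)
    (hG : ∀ s, ContinuousOn (fun y => G y s) (Set.Ici M.d)) {x : ℝ} (hx : 0 ≤ x) (s : S) :
    IsLeast (M.costs G x s) (sInf (M.costs G x s)) := by
  rw [costs_eq_image hM G hx]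
  refine (isCompact_Icc.image ?_).isLeast_sInf ((Set.nonempty_Icc.2 (hM.zmax_pos s).le).image _)
  exact (continuous_objective hG s).comp (Continuous.prodMk_right x)

theorem continuousOn_sInf_costs (hM : M.Assumptions)
    (hG : ∀ s, ContinuousOn (fun y => G y s) (Set.Ici M.d)) (s : S) :
    ContinuousOn (fun x => sInf (M.costs G x s)) (Set.Ici 0) := by
  have h : Continuous fun x => sInf ((fun r => M.objective G x r s) '' Set.Icc 0 (M.zmax s)) :=
    isCompact_Icc.continuous_sInf (f := fun x r => M.objective G x r s) (continuous_objective hG s)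
  exact h.continuousOn.congr fun x hx => by simp only [costs_eq_image hM G hx s]

theorem measurable_sInf_costs (hM : M.Assumptions)
    (hG : ∀ s, ContinuousOn (fun y => G y s) (Set.Ici M.d))
    (hmeas : ∀ y, M.d ≤ y → Measurable (G y)) {x : ℝ} (hx : 0 ≤ x) :
    Measurable fun s => sInf (M.costs G x s) := by
  refine measurable_of_Iio fun b => ?_
  -- The interval of actions varies with `s`; clamping the rationals into it gives a countable
  -- family of actions that is dense in it for every `s`.
  have hset : (fun s => sInf (M.costs G x s)) ⁻¹' Set.Iio b =
      ⋃ q : ℚ, {s | M.objective G x (max 0 (min q (M.zmax s))) s < b} := by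
    ext s
    have hz := hM.zmax_pos s
    simp only [Set.mem_preimage, Set.mem_Iio, Set.mem_iUnion, Set.mem_ofPred_eq]
    have hleast := isLeast_sInf_costs hM hG hx s
    constructor
    · intro h
      have hmem := hleast.1
      rw [costs_eq_image hM G hx] at hmem h
      obtain ⟨r, hr, hrs⟩ := hmem
      have hcont : Continuous fun q : ℝ => M.objective G x (max 0 (min q (M.zmax s))) s :=
        (continuous_objective hG s).comp
          (by fun_prop : Continuous fun q : ℝ => (x, max 0 (min q (M.zmax s))))
      obtain ⟨q, hq⟩ := Rat.denseRange_cast.exists_mem_open (hcont.isOpen_preimage _ isOpen_Iio)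
        ⟨r, show M.objective G x (max 0 (min r (M.zmax s))) s < b by
          rw [min_eq_left hr.2, max_eq_right hr.1]
          exact lt_of_eq_of_lt hrs h⟩
      exact ⟨q, hq⟩
    · rintro ⟨q, hq⟩
      refine lt_of_le_of_lt (hleast.2 ?_) hq
      rw [costs_eq_image hM G hx]
      exact ⟨_, ⟨le_max_left _ _, max_le hz.le (min_le_right _ _)⟩, rfl⟩
  rw [hset]
  refine MeasurableSet.iUnion fun q => measurableSet_lt ?_ measurable_const
  exact (measurable_objective hM hG hmeas x).comp
    ((measurable_const.max (measurable_const.min hM.measurable_zmax)).prodMk measurable_id)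

/-- The feasible pairs `(x, z)` form a convex set on which the cost is jointly convex, so mixing two
minimizers gives a feasible competitor. -/
theorem convexOn_sInf_costs (hM : M.Assumptions)
    (hG : ∀ s, ContinuousOn (fun y => G y s) (Set.Ici M.d))
    (hconv : ∀ s, ConvexOn ℝ (Set.Ici M.d) fun y => G y s) (s : S) :
    ConvexOn ℝ (Set.Ici 0) fun x => sInf (M.costs G x s) := by
  refine ⟨convex_Ici _, fun x hx x' hx' a b ha hb hab => ?_⟩
  have hx0 : 0 ≤ x := hx
  have hx0' : 0 ≤ x' := hx'
  obtain ⟨z, hz, hzv⟩ := (isLeast_sInf_costs hM hG hx s).1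
  obtain ⟨z', hz', hzv'⟩ := (isLeast_sInf_costs hM hG hx' s).1
  have hx2 : 0 ≤ a * x + b * x' := by positivity
  simp only [smul_eq_mul] at hzv hzv' ⊢
  rw [← hzv, ← hzv']
  rw [mem_actions] at hz hz'
  have hy : M.d ≤ a * (x + z) + b * (x' + z') := by
    have h1 := mul_le_mul_of_nonneg_left hz.2.1 ha
    have h2 := mul_le_mul_of_nonneg_left hz'.2.1 hb
    have h3 : M.d = a * M.d + b * M.d := by rw [← add_mul, hab, one_mul]
    linarith
  have hmem : a * z + b * z' ∈ M.actions (a * x + b * x') s := by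
    refine mem_actions.2 ⟨add_nonneg (mul_nonneg ha hz.1) (mul_nonneg hb hz'.1), by linarith, ?_⟩
    have h1 := mul_le_mul_of_nonneg_left hz.2.2 ha
    have h2 := mul_le_mul_of_nonneg_left hz'.2.2 hb
    have h3 : M.zmax s = a * M.zmax s + b * M.zmax s := by rw [← add_mul, hab, one_mul]
    linarith
  refine ((isLeast_sInf_costs hM hG hx2 s).2 ⟨_, hmem, rfl⟩).trans ?_
  have h1 := (hM.c_convexOn s).2 (Set.mem_univ z) (Set.mem_univ z') ha hb hab
  have h2 := (hconv s).2 (show x + z ∈ Set.Ici M.d from hz.2.1)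
    (show x' + z' ∈ Set.Ici M.d from hz'.2.1) ha hb hab
  simp only [smul_eq_mul] at h1 h2
  dsimp only
  rw [show a * x + b * x' + (a * z + b * z') = a * (x + z) + b * (x' + z') by ring]
  linarith

/-- Dynamic programming preserves the properties of a cost-to-go. -/
theorem CostToGo.bellman (hM : M.Assumptions) (hW : M.CostToGo W) :
    M.CostToGo fun x s => sInf (M.costs (M.after W) x s) := by
  have hcont := hW.after_continuousOn hM
  refine ⟨fun x hx s => ?_, fun x hx s => ?_, ?_, ?_, fun x hx => ?_⟩
  · obtain ⟨z, hz, hzv⟩ := (isLeast_sInf_costs hM hcont hx s).1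
    rw [← hzv]
    rw [mem_actions] at hz
    exact add_nonneg (hM.c_nonneg s hz.1) (hW.after_nonneg hM hz.2.1 s)
  · refine ((isLeast_sInf_costs hM hcont hx s).2 ⟨_, hM.d_mem_actions hx s, rfl⟩).trans ?_
    have h1 := (hM.c_le_iff s M.d).2 (hM.d_le_zmax s)
    have h2 := hW.after_le hM (y := x + M.d) (by linarith) s
    rw [add_sub_cancel_right] at h2
    have h3 := hM.bound_eq x
    simp only
    linarith
  · exact convexOn_sInf_costs hM hcont (hW.after_convexOn hM)
  · exact continuousOn_sInf_costs hM hcont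
  · exact measurable_sInf_costs hM hcont (fun y hy => hW.after_measurable hy) hx

end Model

/-! ### The infinite-horizon limit and the optimality equation. -/

namespace Model

variable {S : Type*} [MeasurableSpace S] {M : Model S} {W W' G G' : ℝ → S → ℝ}

theorem sInf_costs_mono (hM : M.Assumptions)
    (hG : ∀ s, ContinuousOn (fun y => G y s) (Set.Ici M.d))
    (hG' : ∀ s, ContinuousOn (fun y => G' y s) (Set.Ici M.d)) {s : S}
    (h : ∀ y, M.d ≤ y → G y s ≤ G' y s) {x : ℝ} (hx : 0 ≤ x) :
    sInf (M.costs G x s) ≤ sInf (M.costs G' x s) := by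
  obtain ⟨z, hz, hzv⟩ := (isLeast_sInf_costs hM hG' hx s).1
  rw [← hzv]
  refine ((isLeast_sInf_costs hM hG hx s).2 ⟨z, hz, rfl⟩).trans ?_
  exact add_le_add le_rfl (h _ (mem_actions.1 hz).2.1)

theorem g_succ (M : Model S) (n : ℕ) : M.g (n + 1) = M.after (M.V n) := rfl

namespace Assumptions

theorem bound_nonneg (hM : M.Assumptions) (s : S) {x : ℝ} (hx : 0 ≤ x) : 0 ≤ M.bound x :=
  div_nonneg (add_nonneg (hM.P_nonneg s) (hM.h_nonneg x hx)) (by linarith [hM.α_lt_one])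

theorem costToGo_V (hM : M.Assumptions) (n : ℕ) : M.CostToGo (M.V n) := by
  induction n with
  | zero =>
    exact ⟨fun _ _ _ => le_rfl, fun x hx s => hM.bound_nonneg s hx,
      fun _ => convexOn_const 0 (convex_Ici _), fun _ => continuousOn_const,
      fun _ _ => measurable_const⟩
  | succ n ih => exact ih.bellman hM

theorem coercive_g (hM : M.Assumptions) (n : ℕ) (s : S) :
    CoerciveConvexOn M.d fun y => M.g n y s :=
  (hM.costToGo_V (n - 1)).after_coercive hM s

theorem isLeast_V (hM : M.Assumptions) (n : ℕ) {x : ℝ} (hx : 0 ≤ x) (s : S) :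
    IsLeast (M.costs (M.g (n + 1)) x s) (M.V (n + 1) x s) :=
  isLeast_sInf_costs hM (fun s => (hM.coercive_g (n + 1) s).cont) hx s

theorem V_le_succ (hM : M.Assumptions) (n : ℕ) {x : ℝ} (hx : 0 ≤ x) (s : S) :
    M.V n x s ≤ M.V (n + 1) x s := by
  induction n generalizing x s with
  | zero => exact (hM.costToGo_V 1).nonneg x hx s
  | succ n ih =>
    exact sInf_costs_mono hM (fun s => (hM.coercive_g (n + 1) s).cont)
      (fun s => (hM.coercive_g (n + 2) s).cont)
      (fun y hy => (hM.costToGo_V n).after_mono hM (hM.costToGo_V (n + 1))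
        (fun x hx s => ih hx s) hy s) hx

theorem V_mono (hM : M.Assumptions) {x : ℝ} (hx : 0 ≤ x) (s : S) :
    Monotone fun n => M.V n x s :=
  monotone_nat_of_le_succ fun n => hM.V_le_succ n hx s

theorem V_tendsto (hM : M.Assumptions) {x : ℝ} (hx : 0 ≤ x) (s : S) :
    Tendsto (fun n => M.V n x s) atTop (𝓝 (M.Vinf x s)) := by
  have h := tendsto_atTop_ciSup (hM.V_mono hx s)
    ⟨M.bound x, by rintro _ ⟨n, rfl⟩; exact (hM.costToGo_V n).le_bound x hx s⟩
  rw [Vinf, h.limUnder_eq]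
  exact h

theorem V_le_Vinf (hM : M.Assumptions) (n : ℕ) {x : ℝ} (hx : 0 ≤ x) (s : S) :
    M.V n x s ≤ M.Vinf x s :=
  (hM.V_mono hx s).ge_of_tendsto (hM.V_tendsto hx s) n

theorem costToGo_Vinf (hM : M.Assumptions) : M.CostToGo M.Vinf := by
  have hconv : ∀ s, ConvexOn ℝ (Set.Ici 0) fun x => M.Vinf x s := by
    refine fun s => ⟨convex_Ici _, fun x hx y hy a b ha hb hab => ?_⟩
    have hz : a • x + b • y ∈ Set.Ici (0 : ℝ) := (convex_Ici 0) hx hy ha hb hab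
    exact le_of_tendsto_of_tendsto' (hM.V_tendsto hz s)
      (((hM.V_tendsto hx s).const_smul a).add ((hM.V_tendsto hy s).const_smul b))
      fun n => ((hM.costToGo_V n).convex s).2 hx hy ha hb hab
  refine ⟨fun x hx s => ?_, fun x hx s => ?_, hconv, fun s => ?_, fun x hx => ?_⟩
  · exact hM.V_le_Vinf 0 hx s
  · exact le_of_tendsto' (hM.V_tendsto hx s) fun n => (hM.costToGo_V n).le_bound x hx s
  -- If `Vinf 0 s > r`, some iterate exceeds `r` at 0, hence near 0, and `Vinf` dominates that
  -- iterate.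
  · refine (hconv s).continuousOn_Ici_of_lowerSemicontinuousWithinAt fun r hr => ?_
    obtain ⟨n, hn⟩ := ((hM.V_tendsto le_rfl s).eventually_const_lt hr).exists
    have := ((hM.costToGo_V n).cont s 0 Set.self_mem_Ici).eventually_const_lt hn
    filter_upwards [this, self_mem_nhdsWithin] with x hx hx0
    exact hx.trans_le (hM.V_le_Vinf n hx0 s)
  · exact measurable_of_tendsto_metrizable (fun n => (hM.costToGo_V n).meas x hx)
      (tendsto_pi_nhds.2 fun s => hM.V_tendsto hx s)

theorem coercive_ginf (hM : M.Assumptions) (s : S) :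
    CoerciveConvexOn M.d fun y => M.ginf y s :=
  hM.costToGo_Vinf.after_coercive hM s

theorem g_mono (hM : M.Assumptions) {m n : ℕ} (hmn : m ≤ n) {y : ℝ} (hy : M.d ≤ y) (s : S) :
    M.g m y s ≤ M.g n y s :=
  (hM.costToGo_V (m - 1)).after_mono hM (hM.costToGo_V (n - 1))
    (fun _ hx s => hM.V_mono hx s (Nat.sub_le_sub_right hmn 1)) hy s

theorem g_le_ginf (hM : M.Assumptions) (n : ℕ) {y : ℝ} (hy : M.d ≤ y) (s : S) :
    M.g n y s ≤ M.ginf y s :=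
  (hM.costToGo_V (n - 1)).after_mono hM hM.costToGo_Vinf
    (fun _ hx s => hM.V_le_Vinf (n - 1) hx s) hy s

theorem g_tendsto (hM : M.Assumptions) {y : ℝ} (hy : M.d ≤ y) (s : S) :
    Tendsto (fun n => M.g n y s) atTop (𝓝 (M.ginf y s)) := by
  -- Truncated subtraction makes `g 0` equal to `g 1`; the shift discards this index.
  rw [← tendsto_add_atTop_iff_nat 1]
  have hy' : 0 ≤ y - M.d := sub_nonneg.2 hy
  simp only [g_succ]
  unfold ginf after
  refine tendsto_const_nhds.add (Tendsto.const_mul _ ?_)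
  refine tendsto_integral_of_dominated_convergence (fun _ => M.bound (y - M.d))
    (fun n => ((hM.costToGo_V n).meas _ hy').aestronglyMeasurable) (integrable_const _) ?_ ?_
  · refine fun n => ae_of_all _ fun s' => ?_
    rw [Real.norm_eq_abs, abs_of_nonneg ((hM.costToGo_V n).nonneg _ hy' s')]
    exact (hM.costToGo_V n).le_bound _ hy' s'
  · exact ae_of_all _ fun s' => hM.V_tendsto hy' s'

/-- The discounted cost optimality equation. -/
theorem isLeast_Vinf (hM : M.Assumptions) {x : ℝ} (hx : 0 ≤ x) (s : S) :
    IsLeast (M.costs M.ginf x s) (M.Vinf x s) := by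
  have hlower : M.Vinf x s ∈ lowerBounds (M.costs M.ginf x s) := by
    rintro _ ⟨z, hz, rfl⟩
    refine le_of_tendsto' (hM.V_tendsto hx s) fun n => ?_
    refine (hM.V_le_succ n hx s).trans (((hM.isLeast_V n hx s).2 ⟨z, hz, rfl⟩).trans ?_)
    exact add_le_add le_rfl (hM.g_le_ginf (n + 1) (mem_actions.1 hz).2.1 s)
  refine ⟨?_, hlower⟩
  -- The actions whose cost under `g (n + 1)` is at most `Vinf x s` form decreasing nonempty compact
  -- sets. A common point has cost at most `Vinf x s` under `ginf` as well, by passing to the limit.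
  set C : ℕ → Set ℝ := fun n =>
    Set.Icc 0 (M.zmax s) ∩ {r | M.objective (M.g (n + 1)) x r s ≤ M.Vinf x s} with hC
  have hcl : ∀ n, IsClosed {r | M.objective (M.g (n + 1)) x r s ≤ M.Vinf x s} := fun n =>
    isClosed_le ((continuous_objective (fun s => (hM.coercive_g (n + 1) s).cont) s).comp
      (Continuous.prodMk_right x)) continuous_const
  obtain ⟨r, hr⟩ : (⋂ n, C n).Nonempty := by
    refine IsCompact.nonempty_iInter_of_sequence_nonempty_isCompact_isClosed C ?_ ?_
      (isCompact_Icc.inter_right (hcl 0)) fun n => isClosed_Icc.inter (hcl n)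
    · rintro n r ⟨h1, h2⟩
      have h3 : M.objective (M.g (n + 1)) x r s ≤ M.objective (M.g (n + 2)) x r s :=
        add_le_add le_rfl (hM.g_mono (by omega) (le_max_left _ _) s)
      exact ⟨h1, h3.trans h2⟩
    · intro n
      have h := (hM.isLeast_V n hx s).1
      rw [costs_eq_image hM _ hx] at h
      obtain ⟨r, hr, hrv⟩ := h
      exact ⟨r, hr, hrv.le.trans (hM.V_le_Vinf (n + 1) hx s)⟩
  rw [Set.mem_iInter] at hr
  have hle : M.objective M.ginf x r s ≤ M.Vinf x s := by
    have htend : Tendsto (fun n => M.objective (M.g (n + 1)) x r s) atTop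
        (𝓝 (M.objective M.ginf x r s)) :=
      tendsto_const_nhds.add
        ((hM.g_tendsto (le_max_left _ _) s).comp (tendsto_add_atTop_nat 1))
    exact le_of_tendsto' htend fun n => (hr n).2
  have hmem : M.objective M.ginf x r s ∈ M.costs M.ginf x s := by
    rw [costs_eq_image hM _ hx]
    exact ⟨r, (hr 0).1, rfl⟩
  exact le_antisymm hle (hlower hmem) ▸ hmem

end Assumptions

end Model

/-! ### Comparison of horizons and convergence of the critical numbers. -/

/-- Of two pairs with the same sum, the more spread one has the larger sum of values of a convex
function. -/
theorem ConvexOn.add_le_add_of_spread {f : ℝ → ℝ} (hf : ConvexOn ℝ Set.univ f) {p q u v : ℝ}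
    (hpu : p ≤ u) (huq : u ≤ q) (hsum : u + v = p + q) : f u + f v ≤ f p + f q := by
  rcases (hpu.trans huq).eq_or_lt with h | h
  · have hu : u = p := le_antisymm (h ▸ huq) hpu
    have hv : v = q := by linarith
    rw [hu, hv]
  · have hqp : 0 < q - p := sub_pos.2 h
    have ht : 0 ≤ (u - p) / (q - p) := div_nonneg (by linarith) hqp.le
    have ht' : 0 ≤ (q - u) / (q - p) := div_nonneg (by linarith) hqp.le
    have hone : (q - u) / (q - p) + (u - p) / (q - p) = 1 := by field_simp; ring
    have h1 := hf.2 (Set.mem_univ p) (Set.mem_univ q) ht' ht hone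
    have h2 := hf.2 (Set.mem_univ p) (Set.mem_univ q) ht ht' (by linarith)
    simp only [smul_eq_mul] at h1 h2
    have hu : (q - u) / (q - p) * p + (u - p) / (q - p) * q = u := by field_simp; ring
    have hv : (u - p) / (q - p) * p + (q - u) / (q - p) * q = v := by
      rw [show v = p + q - u by linarith]; field_simp; ring
    rw [hu] at h1
    rw [hv] at h2
    have h3 : ∀ t : ℝ, (q - u) / (q - p) * t + (u - p) / (q - p) * t = t := fun t => by
      rw [← add_mul, hone, one_mul]
    linarith [h3 (f p), h3 (f q)]

namespace Model

variable {S : Type*} [MeasurableSpace S] {M : Model S} {W W' G G' : ℝ → S → ℝ}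

/-- If the cost after transmission increases beyond `T`, sending nothing is optimal when the buffer
level is at least `T`. -/
theorem sInf_costs_eq_of_monotoneOn (hM : M.Assumptions)
    (hG : ∀ s, ContinuousOn (fun y => G y s) (Set.Ici M.d)) {s : S} {T : ℝ} (hT : M.d ≤ T)
    (hmono : MonotoneOn (fun y => G y s) (Set.Ici T)) {x : ℝ} (hx : T ≤ x) :
    sInf (M.costs G x s) = G x s := by
  have hx0 : 0 ≤ x := hM.d_pos.le.trans (hT.trans hx)
  refine (isLeast_sInf_costs hM hG hx0 s).unique ⟨⟨0, ?_, ?_⟩, ?_⟩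
  · exact mem_actions.2 ⟨le_rfl, by linarith, (hM.zmax_pos s).le⟩
  · simp only [hM.c_zero, add_zero, zero_add]
  · rintro _ ⟨z, hz, rfl⟩
    have hz0 := (mem_actions.1 hz).1
    have h1 := hmono (show x ∈ Set.Ici T from hx) (show x + z ∈ Set.Ici T from by
      rw [Set.mem_Ici]; linarith) (by linarith)
    have h2 := hM.c_nonneg s hz0
    simp only at h1 ⊢
    linarith

/-- If `G' - G` is nonincreasing on `[d, T']`, and `G` is nondecreasing beyond some level `≤ T'`,
then the difference of the minimal costs is nonincreasing on `[0, T']`. -/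
theorem antitoneOn_sInf_costs_sub (hM : M.Assumptions)
    (hG : ∀ s, ContinuousOn (fun y => G y s) (Set.Ici M.d))
    (hG' : ∀ s, ContinuousOn (fun y => G' y s) (Set.Ici M.d)) {s : S} {T : ℝ} (hT : M.d ≤ T)
    (hanti : AntitoneOn (fun y => G' y s - G y s) (Set.Icc M.d T))
    (hmono : MonotoneOn (fun y => G y s) (Set.Ici T)) :
    AntitoneOn (fun x => sInf (M.costs G' x s) - sInf (M.costs G x s)) (Set.Icc 0 T) := by
  intro x hx x' hx' hxx'
  -- An optimal action for `G` at `x'` that overshoots `T` can be shortened to reach exactly `T`,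
  -- since neither the power nor `G` increases.
  obtain ⟨z', hz', y', hy'z, hy'T, hv'⟩ : ∃ z' ∈ M.actions x' s, ∃ y', y' = x' + z' ∧ y' ≤ T ∧
      M.c z' s + G y' s ≤ sInf (M.costs G x' s) := by
    obtain ⟨z, hz, hv⟩ := (isLeast_sInf_costs hM hG hx'.1 s).1
    rw [mem_actions] at hz
    rw [← hv]
    rcases le_total (x' + z) T with h | h
    · exact ⟨z, mem_actions.2 hz, _, rfl, h, le_rfl⟩
    · refine ⟨T - x', mem_actions.2 ⟨sub_nonneg.2 hx'.2, by linarith, by linarith [hz.2.2]⟩, T,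
        by ring, le_rfl, add_le_add ?_ ?_⟩
      · exact (hM.c_strictMono s).monotone (by linarith)
      · exact hmono Set.self_mem_Ici (show x' + z ∈ Set.Ici T from h) h
  obtain ⟨z, hz, hv⟩ := (isLeast_sInf_costs hM hG' hx.1 s).1
  have hL' := (isLeast_sInf_costs hM hG' hx'.1 s).2
  have hL := (isLeast_sInf_costs hM hG hx.1 s).2
  rw [mem_actions] at hz hz'
  simp only at hv ⊢
  -- If the target levels are ordered like `x` and `x'`, each action is kept and the two functions
  -- are exchanged, using that `G' - G` is nonincreasing. Otherwise the target levels are exchanged: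
  -- the `G'` and `G` terms are unchanged, and the power drops because the two actions are less
  -- spread.
  rcases le_or_gt (x + z) y' with h | h
  · have h1 := hL' ⟨z', mem_actions.2 hz', rfl⟩
    have h2 := hL ⟨z, mem_actions.2 hz, rfl⟩
    have h3 := hanti (show x + z ∈ Set.Icc M.d T from ⟨hz.2.1, h.trans hy'T⟩)
      (show y' ∈ Set.Icc M.d T from ⟨hy'z ▸ hz'.2.1, hy'T⟩) h
    simp only [← hy'z] at h1 h2 h3
    linarith
  · have h1 := hL' ⟨x + z - x', mem_actions.2
      ⟨by linarith, by linarith [hz.2.1], by linarith [hz.2.2]⟩, rfl⟩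
    have h2 := hL ⟨y' - x, mem_actions.2
      ⟨by linarith, by linarith [hz'.2.1], by linarith [hz.2.2]⟩, rfl⟩
    have h3 := (hM.c_convexOn s).add_le_add_of_spread (p := y' - x') (q := z) (u := x + z - x')
      (v := y' - x) (by linarith) (by linarith) (by ring)
    simp only [add_sub_cancel] at h1 h2 h3
    rw [show z' = y' - x' by linarith] at hv'
    linarith

namespace Assumptions

theorem after_monotoneOn (hM : M.Assumptions) (hW : M.CostToGo W) {T : ℝ} (hT : 0 ≤ T)
    (hmono : ∀ s, MonotoneOn (fun x => W x s) (Set.Ici T)) (s : S) :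
    MonotoneOn (fun y => M.after W y s) (Set.Ici (T + M.d)) := by
  intro y hy y' hy' hyy'
  have h1 : T ≤ y - M.d := le_sub_iff_add_le.2 hy
  have h1' : T ≤ y' - M.d := le_sub_iff_add_le.2 hy'
  have h2 := hM.h_mono (show y - M.d ∈ Set.Ici 0 from hT.trans h1)
    (show y' - M.d ∈ Set.Ici 0 from hT.trans h1') (by linarith)
  have h3 := integral_mono (hW.integrable (hT.trans h1) s) (hW.integrable (hT.trans h1') s)
    fun s' => hmono s' h1 h1' (by linarith)
  exact add_le_add h2 (mul_le_mul_of_nonneg_left h3 hM.α_nonneg)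

theorem after_sub_antitoneOn (hM : M.Assumptions) (hW : M.CostToGo W) (hW' : M.CostToGo W')
    {T : ℝ} (hanti : ∀ s, AntitoneOn (fun x => W' x s - W x s) (Set.Icc 0 T)) (s : S) :
    AntitoneOn (fun y => M.after W' y s - M.after W y s) (Set.Icc M.d (T + M.d)) := by
  intro y hy y' hy' hyy'
  have h1 : 0 ≤ y - M.d := sub_nonneg.2 hy.1
  have h1' : 0 ≤ y' - M.d := sub_nonneg.2 hy'.1
  have h3 : ∫ s', (W' (y' - M.d) s' - W (y' - M.d) s') ∂(M.kernel s) ≤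
      ∫ s', (W' (y - M.d) s' - W (y - M.d) s') ∂(M.kernel s) :=
    integral_mono ((hW'.integrable h1' s).sub (hW.integrable h1' s))
      ((hW'.integrable h1 s).sub (hW.integrable h1 s)) fun s' =>
        hanti s' ⟨h1, by linarith [hy.2]⟩ ⟨h1', by linarith [hy'.2]⟩ (by linarith)
  rw [integral_sub (hW'.integrable h1' s) (hW.integrable h1' s),
    integral_sub (hW'.integrable h1 s) (hW.integrable h1 s)] at h3
  have h4 := mul_le_mul_of_nonneg_left h3 hM.α_nonneg
  simp only [after]
  linarith

/-- A buffer level that covers the whole horizon can only be reduced at no cost. -/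
theorem V_monotoneOn (hM : M.Assumptions) (n : ℕ) (s : S) :
    MonotoneOn (fun x => M.V n x s) (Set.Ici (n * M.d)) := by
  induction n generalizing s with
  | zero => exact monotoneOn_const
  | succ n ih =>
    have hd := hM.d_pos
    have hT : (0 : ℝ) ≤ n * M.d := by positivity
    have hmono := hM.after_monotoneOn (hM.costToGo_V n) hT ih s
    have hcast : ((n + 1 : ℕ) : ℝ) * M.d = n * M.d + M.d := by push_cast; ring
    rw [hcast]
    -- Beyond this level sending nothing is optimal, so `V (n + 1)` coincides with `g (n + 1)`.
    refine hmono.congr fun x hx => ?_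
    exact (sInf_costs_eq_of_monotoneOn hM (fun s => (hM.coercive_g (n + 1) s).cont)
      (by linarith) hmono hx).symm

theorem g_monotoneOn (hM : M.Assumptions) (n : ℕ) (s : S) :
    MonotoneOn (fun y => M.g (n + 1) y s) (Set.Ici (n * M.d + M.d)) :=
  hM.after_monotoneOn (hM.costToGo_V n) (mul_nonneg n.cast_nonneg hM.d_pos.le)
    (hM.V_monotoneOn n) s

/-- With one more slot to go, additional packets in the buffer are worth more, as long as the
horizon is not covered. -/
theorem V_sub_antitoneOn (hM : M.Assumptions) (n : ℕ) (s : S) :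
    AntitoneOn (fun x => M.V (n + 1) x s - M.V n x s) (Set.Icc 0 (n * M.d + M.d)) := by
  induction n generalizing s with
  | zero =>
    -- With one slot left, the cheapest choice is to send just what is missing; the buffer empties
    -- and `h 0 = 0`.
    have hV : ∀ x ∈ Set.Icc 0 M.d, M.V 1 x s = M.c (M.d - x) s := by
      intro x hx
      refine (hM.isLeast_V 0 hx.1 s).unique ⟨⟨M.d - x, ?_, ?_⟩, ?_⟩
      · exact mem_actions.2 ⟨by linarith [hx.2], by linarith,
          by linarith [hx.1, hM.d_le_zmax s]⟩
      · simp [g, after, V, hM.h_zero]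
      · rintro _ ⟨z, hz, rfl⟩
        have hz := mem_actions.1 hz
        have h1 := (hM.costToGo_V 0).after_nonneg hM hz.2.1 s
        have h2 := (hM.c_strictMono s).monotone (show M.d - x ≤ z by linarith [hz.2.1])
        simp only [g_succ] at h2 ⊢
        linarith
    intro x hx x' hx' hxx'
    simp only [CharP.cast_eq_zero, zero_mul, zero_add] at hx hx'
    simp only [V, sub_zero]
    have := (hM.c_strictMono s).monotone (show M.d - x' ≤ M.d - x by linarith)
    have h1 := hV x hx
    have h2 := hV x' hx'
    simp only [V] at h1 h2
    rw [h1, h2]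
    exact this
  | succ n ih =>
    have hd := hM.d_pos
    have hT : (0 : ℝ) ≤ n * M.d := by positivity
    have hcast : ((n + 1 : ℕ) : ℝ) * M.d = n * M.d + M.d := by push_cast; ring
    rw [hcast]
    -- The interval grows by `d` in each round: the playout shifts it from `[0, n d + d]` to `[d, n
    -- d + 2 d]`, and the minimization extends it down to 0.
    refine antitoneOn_sInf_costs_sub hM (fun s => (hM.coercive_g (n + 1) s).cont)
      (fun s => (hM.coercive_g (n + 2) s).cont) (by linarith) ?_ ?_
    · exact hM.after_sub_antitoneOn (hM.costToGo_V n) (hM.costToGo_V (n + 1)) ih s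
    · refine (hM.g_monotoneOn n s).mono (Set.Ici_subset_Ici.2 (by linarith))

theorem g_sub_antitoneOn (hM : M.Assumptions) (n : ℕ) (s : S) :
    AntitoneOn (fun y => M.g (n + 2) y s - M.g (n + 1) y s)
      (Set.Icc M.d (n * M.d + M.d + M.d)) :=
  hM.after_sub_antitoneOn (hM.costToGo_V n) (hM.costToGo_V (n + 1)) (hM.V_sub_antitoneOn n) s

/-- Packets beyond what `n + 1` slots play out have no value. This places the critical numbers
inside the interval of `g_sub_antitoneOn`, as `crit_le_crit` requires. -/
theorem crit_g_le (hM : M.Assumptions) (n : ℕ) {k : ℕ} (hk : k ≤ M.K) (s : S) :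
    M.crit (M.g (n + 1)) k s ≤ n * M.d + M.d := by
  have hd := hM.d_pos
  have hT : (0 : ℝ) ≤ n * M.d := by positivity
  refine crit_le (hM.coercive_g (n + 1) s).convex (by linarith) fun y hy => ?_
  exact add_le_add (hM.g_monotoneOn n s Set.self_mem_Ici hy hy)
    (mul_le_mul_of_nonneg_left hy (hM.slope_pos' s hk).le)

/-- Differences to later iterates are nonincreasing as well. -/
theorem g_add_sub_antitoneOn (hM : M.Assumptions) (n j : ℕ) (s : S) :
    AntitoneOn (fun y => M.g (n + 1 + j) y s - M.g (n + 1) y s)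
      (Set.Icc M.d (n * M.d + M.d + M.d)) := by
  induction j with
  | zero => simpa using antitoneOn_const
  | succ j ih =>
    have hd := hM.d_pos
    have hsub : Set.Icc M.d (n * M.d + M.d + M.d) ⊆
        Set.Icc M.d (((n + j : ℕ) : ℝ) * M.d + M.d + M.d) :=
      Set.Icc_subset_Icc_right (by
        push_cast
        nlinarith [mul_nonneg (Nat.cast_nonneg (α := ℝ) j) hd.le])
    have h := (hM.g_sub_antitoneOn (n + j) s).mono hsub
    refine (ih.add h).congr fun y _ => ?_
    simp only [show n + j + 2 = n + 1 + (j + 1) by ring,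
      show n + j + 1 = n + 1 + j by ring]
    ring

/-- If `G' - G` is nonincreasing on `[d, T]` and `crit G k ≤ T` then the critical number of `G'` is
not smaller than that of `G`. -/
theorem crit_le_crit (hM : M.Assumptions) {k : ℕ} (hk : k ≤ M.K) {s : S}
    (hG : CoerciveConvexOn M.d fun y => G y s) (hG' : CoerciveConvexOn M.d fun y => G' y s) {T : ℝ}
    (hanti : AntitoneOn (fun y => G' y s - G y s) (Set.Icc M.d T)) (hT : M.crit G k s ≤ T) :
    M.crit G k s ≤ M.crit G' k s := by
  -- From `crit G' k` up to `crit G k` the tilted `G` drops strictly; the tilted `G'` drops at least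
  -- as much, although it is minimal at `crit G' k`.
  by_contra! hlt
  have hk0 := (hM.slope_pos' s hk).le
  have hd := M.d_le_crit G' k s
  have h1 := lt_of_lt_crit hG hk0 hd hlt
  have h2 := hanti ⟨hd, hlt.le.trans hT⟩ ⟨hd.trans hlt.le, hT⟩ hlt.le
  have h3 := crit_isMin hG' hk0 (hd.trans hlt.le)
  simp only at h2
  linarith

theorem crit_g_mono (hM : M.Assumptions) {k : ℕ} (hk : k ≤ M.K) (s : S) :
    Monotone fun n => M.crit (M.g (n + 1)) k s :=
  monotone_nat_of_le_succ fun n =>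
    hM.crit_le_crit hk (hM.coercive_g (n + 1) s) (hM.coercive_g (n + 2) s)
      (hM.g_sub_antitoneOn n s) ((hM.crit_g_le n hk s).trans (by linarith [hM.d_pos]))

/-- The interval in `g_add_sub_antitoneOn` depends on `n` only, so `j` can tend to infinity. -/
theorem crit_g_le_ginf (hM : M.Assumptions) (n : ℕ) {k : ℕ} (hk : k ≤ M.K) (s : S) :
    M.crit (M.g (n + 1)) k s ≤ M.crit M.ginf k s := by
  refine hM.crit_le_crit hk (hM.coercive_g (n + 1) s) (hM.coercive_ginf s)
    (T := n * M.d + M.d + M.d) ?_ ((hM.crit_g_le n hk s).trans (by linarith [hM.d_pos]))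
  intro y hy y' hy' hyy'
  have htend : ∀ y, M.d ≤ y → Tendsto (fun j => M.g (n + 1 + j) y s - M.g (n + 1) y s) atTop
      (𝓝 (M.ginf y s - M.g (n + 1) y s)) := fun y hy => by
    refine ((hM.g_tendsto hy s).comp ?_).sub_const _
    exact (tendsto_add_atTop_nat (n + 1)).congr fun j => add_comm _ _
  exact le_of_tendsto_of_tendsto' (htend y' hy'.1) (htend y hy.1)
    fun j => hM.g_add_sub_antitoneOn n j s hy hy' hyy'

/-- Convergence of the critical numbers. -/
theorem crit_tendsto (hM : M.Assumptions) {k : ℕ} (hk : k ≤ M.K) (s : S) :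
    Tendsto (fun n => M.crit (M.g n) k s) atTop (𝓝 (M.crit M.ginf k s)) := by
  have hk0 := (hM.slope_pos' s hk).le
  have hbdd : BddAbove (Set.range fun n => M.crit (M.g (n + 1)) k s) :=
    ⟨M.crit M.ginf k s, by rintro _ ⟨n, rfl⟩; exact hM.crit_g_le_ginf n hk s⟩
  have htend := tendsto_atTop_ciSup (hM.crit_g_mono hk s) hbdd
  rw [← tendsto_add_atTop_iff_nat 1]
  suffices (⨆ n, M.crit (M.g (n + 1)) k s) = M.crit M.ginf k s by rwa [this] at htend
  refine le_antisymm (ciSup_le fun n => hM.crit_g_le_ginf n hk s) ?_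
  have hle : ∀ n, M.crit (M.g (n + 1)) k s ≤ ⨆ n, M.crit (M.g (n + 1)) k s := le_ciSup hbdd
  have hd : M.d ≤ ⨆ n, M.crit (M.g (n + 1)) k s := (M.d_le_crit _ k s).trans (hle 0)
  -- The supremum lies to the right of every `crit (g (n + 1)) k`, so each tilted `g (n + 1)` is
  -- nondecreasing from there on, and so is the limit.
  refine crit_le (hM.coercive_ginf s).convex hd fun y hy => ?_
  have h1 : ∀ y, M.d ≤ y → Tendsto (fun n => M.g (n + 1) y s + M.slope k s * y) atTop
      (𝓝 (M.ginf y s + M.slope k s * y)) := fun y hy =>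
    ((hM.g_tendsto hy s).comp (tendsto_add_atTop_nat 1)).add_const _
  exact le_of_tendsto_of_tendsto' (h1 _ hd) (h1 y (hd.trans hy)) fun n =>
    add_slope_le_of_crit_le (hM.coercive_g (n + 1) s) hk0 (hle n) hy

end Assumptions

end Model

/-! ### The base-stock rule as a threshold. -/

namespace Model

variable {S : Type*} [MeasurableSpace S] {M : Model S} {G : ℝ → S → ℝ} {x z : ℝ} {s : S}

/-- `w` lies in segment `k` of the power-rate curve, the left end being included. -/
def InSegment (M : Model S) (k : ℕ) (s : S) (w : ℝ) : Prop :=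
  k ≤ M.K ∧ M.brkPrev k s ≤ w ∧ (k < M.K → w < M.brk k s)

theorem exists_inSegment (M : Model S) (s : S) {w : ℝ} (hw : 0 ≤ w) : ∃ k, M.InSegment k s w := by
  suffices h : ∀ n ≤ M.K, ∃ k ≤ n, M.brkPrev k s ≤ w ∧ (k < n → w < M.brk k s) from h M.K le_rfl
  intro n
  induction n with
  | zero => exact fun _ => ⟨0, le_rfl, by rwa [brkPrev_zero], fun h => absurd h (lt_irrefl 0)⟩
  | succ n ih =>
    intro hn
    obtain ⟨k, hk, h1, h2⟩ := ih (by omega)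
    rcases le_or_gt (M.brk n s) w with h | h
    · exact ⟨n + 1, le_rfl, by rwa [brkPrev_succ], fun h => absurd h (lt_irrefl _)⟩
    · refine ⟨k, by omega, h1, fun _ => ?_⟩
      rcases hk.eq_or_lt with rfl | hk
      · exact h
      · exact h2 hk

/-- The mirror image of `exists_inSegment`, with segments closed on the right; it supplies the slope
met when fewer packets are sent. -/
theorem exists_segment_left (M : Model S) (s : S) {w : ℝ} (hw : 0 < w) :
    ∃ k ≤ M.K, M.brkPrev k s < w ∧ (k < M.K → w ≤ M.brk k s) := by
  suffices h : ∀ n ≤ M.K, ∃ k ≤ n, M.brkPrev k s < w ∧ (k < n → w ≤ M.brk k s) from h M.K le_rfl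
  intro n
  induction n with
  | zero => exact fun _ => ⟨0, le_rfl, by rwa [brkPrev_zero], fun h => absurd h (lt_irrefl 0)⟩
  | succ n ih =>
    intro hn
    obtain ⟨k, hk, h1, h2⟩ := ih (by omega)
    rcases lt_or_ge (M.brk n s) w with h | h
    · exact ⟨n + 1, le_rfl, by rwa [brkPrev_succ], fun h => absurd h (lt_irrefl _)⟩
    · refine ⟨k, by omega, h1, fun _ => ?_⟩
      rcases hk.eq_or_lt with rfl | hk
      · exact h
      · exact h2 hk

/-- The action `z` passes a point `w` of segment `k` exactly if the buffer level after sending `w`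
packets is below the critical number of index `k`. -/
structure IsThreshold (M : Model S) (G : ℝ → S → ℝ) (x : ℝ) (s : S) (z : ℝ) : Prop where
  nonneg : 0 ≤ z
  le_zmax : z ≤ M.zmax s
  lt_iff : ∀ k w, M.InSegment k s w → w < M.zmax s → (w < z ↔ x + w < M.crit G k s)

/-- If `z < z'`, the criterion at `w = z` gives contradictory answers for the two. -/
theorem IsThreshold.unique {z z' : ℝ} (h : M.IsThreshold G x s z) (h' : M.IsThreshold G x s z') :
    z = z' := by
  have key : ∀ {z z'}, M.IsThreshold G x s z → M.IsThreshold G x s z' → ¬ z < z' := by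
    intro z z' h h' hlt
    obtain ⟨k, hk⟩ := M.exists_inSegment s h.nonneg
    have hz := hlt.trans_le h'.le_zmax
    exact lt_irrefl z ((h.lt_iff k z hk hz).2 ((h'.lt_iff k z hk hz).1 hlt))
  exact le_antisymm (not_lt.1 (key h' h)) (not_lt.1 (key h h'))

theorem critPrev_sub_zero (M : Model S) (G : ℝ → S → ℝ) (x : ℝ) (s : S) :
    (x : EReal) ≤ M.critPrev G 0 s - (M.brkPrev 0 s : EReal) := by
  rw [critPrev, if_pos rfl, EReal.top_sub_coe]
  exact le_top

theorem le_critPrev_sub_iff (M : Model S) (G : ℝ → S → ℝ) (k : ℕ) (x : ℝ) (s : S) :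
    (x : EReal) ≤ M.critPrev G (k + 1) s - (M.brkPrev (k + 1) s : EReal) ↔
      x ≤ M.crit G k s - M.brk k s := by
  rw [critPrev, if_neg (Nat.succ_ne_zero k), brkPrev_succ, Nat.add_sub_cancel, ← EReal.coe_sub,
    EReal.coe_le_coe_iff]

theorem exists_isBaseStock (hx : 0 ≤ x ∨ M.crit G M.K s - M.zmax s < x) :
    ∃ z, M.IsBaseStock G x s z := by
  classical
  rcases le_or_gt x (M.crit G M.K s - M.zmax s) with h4 | h4
  · exact ⟨_, Or.inr (Or.inr (Or.inr ⟨hx.resolve_right (not_lt.2 h4), h4, rfl⟩))⟩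
  -- The first index with this property decides. If it is `k + 1`, then `x ≤ crit G k - brkPrev k`,
  -- and the position of `x` relative to `crit G k - brk k` selects between stopping at the
  -- breakpoint and filling up to `crit G k`.
  by_cases hex : ∃ k, k ≤ M.K ∧ M.crit G k s - M.brkPrev k s < x
  · obtain ⟨hk, hkx⟩ := Nat.find_spec hex
    have hmin := fun j => Nat.find_min hex (m := j)
    generalize Nat.find hex = k at hk hkx hmin
    cases k with
    | zero => exact ⟨_, Or.inl ⟨0, hk, hkx, M.critPrev_sub_zero G x s, rfl⟩⟩
    | succ k =>
      have h1 := hmin k (Nat.lt_succ_self k)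
      have h2 : x ≤ M.crit G k s - M.brkPrev k s := by
        by_contra! h
        exact h1 ⟨by omega, h⟩
      rcases le_or_gt x (M.crit G k s - M.brk k s) with h | h
      · exact ⟨_, Or.inl ⟨k + 1, hk, hkx, (M.le_critPrev_sub_iff G k x s).2 h, rfl⟩⟩
      · exact ⟨_, Or.inr (Or.inl ⟨k, hk, h, h2, rfl⟩)⟩
  · push Not at hex
    exact ⟨_, Or.inr (Or.inr (Or.inl ⟨h4, hex M.K le_rfl, rfl⟩))⟩

theorem InSegment.lt_brkPrev (hM : M.Assumptions) {j k : ℕ} {w : ℝ}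
    (h : M.InSegment j s w) (hjk : j < k) (hk : k ≤ M.K) : w < M.brkPrev k s := by
  refine (h.2.2 (by omega)).trans_le ?_
  rw [← brkPrev_succ]
  exact hM.brkPrev_le s hjk hk

namespace Assumptions

theorem crit_le_of_le (hM : M.Assumptions) (hG : CoerciveConvexOn M.d fun y => G y s) {j k : ℕ}
    (hjk : j ≤ k) (hk : k ≤ M.K) : M.crit G k s ≤ M.crit G j s :=
  crit_antitone hG (hM.slope_pos' s (hjk.trans hk)).le (hM.slope_le s hjk hk)

/-- An action in segment `k` that moves the buffer level to `crit G k` is a threshold. -/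
theorem isThreshold_crit_sub (hM : M.Assumptions) (hG : CoerciveConvexOn M.d fun y => G y s)
    {k : ℕ} (hk : k ≤ M.K) (h1 : M.brkPrev k s ≤ M.crit G k s - x)
    (h2 : k < M.K → M.crit G k s - x < M.brk k s) (h3 : M.crit G k s - x ≤ M.zmax s) :
    M.IsThreshold G x s (M.crit G k s - x) := by
  refine ⟨(hM.brkPrev_nonneg s hk).trans h1, h3, fun j w hj hw => ?_⟩
  rcases lt_trichotomy j k with hjk | rfl | hjk
  · have hlt := (hj.lt_brkPrev hM hjk hk).trans_le h1
    have := hM.crit_le_of_le hG hjk.le hk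
    exact iff_of_true hlt (by linarith)
  · exact lt_sub_iff_add_lt'
  · have hle : M.brk k s ≤ w := by
      refine le_trans ?_ hj.2.1
      rw [← brkPrev_succ]
      exact hM.brkPrev_le s hjk hj.1
    have h4 := h2 (by have := hj.1; omega)
    have := hM.crit_le_of_le hG hjk.le hj.1
    exact iff_of_false (by linarith) (by linarith)

/-- The piecewise definition of the base-stock policy prescribes a threshold. -/
theorem isThreshold_of_isBaseStock (hM : M.Assumptions)
    (hG : CoerciveConvexOn M.d fun y => G y s) (h : M.IsBaseStock G x s z) :
    M.IsThreshold G x s z := by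
  rcases h with ⟨k, hk, h1, h2, rfl⟩ | ⟨k, hk, h1, h2, rfl⟩ | ⟨h1, h2, rfl⟩ | ⟨_, h2, rfl⟩
  · refine ⟨hM.brkPrev_nonneg s hk, (hM.brkPrev_lt_zmax s hk).le, fun j w hj hw => ?_⟩
    rcases lt_or_ge j k with hjk | hjk
    · have hlt := hj.lt_brkPrev hM hjk hk
      refine iff_of_true hlt ?_
      obtain ⟨k, rfl⟩ := Nat.exists_eq_succ_of_ne_zero (by omega : k ≠ 0)
      have h3 := (M.le_critPrev_sub_iff G k x s).1 h2
      have := hM.crit_le_of_le hG (Nat.lt_succ_iff.1 hjk) (Nat.le_of_succ_le hk)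
      rw [brkPrev_succ] at hlt
      linarith
    · have hle := (hM.brkPrev_le s hjk hj.1).trans hj.2.1
      have := hM.crit_le_of_le hG hjk hj.1
      exact iff_of_false (by linarith) (by linarith)
  · have := hM.brkPrev_lt_zmax s (k := k + 1) hk
    rw [brkPrev_succ] at this
    exact hM.isThreshold_crit_sub hG hk.le (by linarith) (fun _ => by linarith) (by linarith)
  · exact hM.isThreshold_crit_sub hG le_rfl (by linarith) (fun h => absurd h (lt_irrefl _))
      (by linarith)
  · refine ⟨(hM.zmax_pos s).le, le_rfl, fun j w hj hw => iff_of_true hw ?_⟩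
    have := hM.crit_le_of_le hG hj.1 le_rfl
    linarith

/-- Disjointness of the alternatives need not be checked: whatever they prescribe is a threshold. -/
theorem existsUnique_isBaseStock (hM : M.Assumptions)
    (hG : CoerciveConvexOn M.d fun y => G y s)
    (hx : 0 ≤ x ∨ M.crit G M.K s - M.zmax s < x) : ∃! z, M.IsBaseStock G x s z := by
  obtain ⟨z, hz⟩ := exists_isBaseStock hx
  exact ⟨z, hz, fun z' hz' => (hM.isThreshold_of_isBaseStock hG hz').unique
    (hM.isThreshold_of_isBaseStock hG hz)⟩

theorem isBaseStock_zstar (hM : M.Assumptions)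
    (hx : 0 ≤ x ∨ M.crit M.ginf M.K s - M.zmax s < x) :
    M.IsBaseStock M.ginf x s (M.zstar x s) := by
  obtain ⟨z, hz, huniq⟩ := hM.existsUnique_isBaseStock (hM.coercive_ginf s) hx
  have : {z : ℝ | M.IsBaseStock M.ginf x s z} = {z} := by
    ext w
    exact ⟨fun h => huniq w h, fun h => Eq.symm h ▸ hz⟩
  rw [zstar, this, csInf_singleton]
  exact hz

theorem isThreshold_zstar (hM : M.Assumptions)
    (hx : 0 ≤ x ∨ M.crit M.ginf M.K s - M.zmax s < x) :
    M.IsThreshold M.ginf x s (M.zstar x s) :=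
  hM.isThreshold_of_isBaseStock (hM.coercive_ginf s) (hM.isBaseStock_zstar hx)

end Assumptions

/-- Below `zmax`, the criterion at `w = z` itself forces `x + z ≥ crit G k ≥ d`; at `zmax`, the
assumption `d ≤ zmax` suffices. -/
theorem IsThreshold.mem_actions (hM : M.Assumptions) (h : M.IsThreshold G x s z) (hx : 0 ≤ x) :
    z ∈ M.actions x s := by
  refine Model.mem_actions.2 ⟨h.nonneg, ?_, h.le_zmax⟩
  rcases h.le_zmax.eq_or_lt with heq | hlt
  · linarith [hM.d_le_zmax s]
  · obtain ⟨k, hk⟩ := M.exists_inSegment s h.nonneg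
    have := (not_congr (h.lt_iff k z hk hlt)).1 (lt_irrefl z)
    exact (M.d_le_crit G k s).trans (not_lt.1 this)

/-- Thresholds are optimal. -/
theorem IsThreshold.cost_le (hM : M.Assumptions) (hG : CoerciveConvexOn M.d fun y => G y s)
    (h : M.IsThreshold G x s z) (hx : 0 ≤ x) {z' : ℝ} (hz' : z' ∈ M.actions x s) :
    M.c z s + G (x + z) s ≤ M.c z' s + G (x + z') s := by
  have hz := Model.mem_actions.1 (h.mem_actions hM hx)
  rw [Model.mem_actions] at hz'
  rcases lt_trichotomy z z' with hlt | rfl | hlt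
  -- Sending more: power grows at least at rate `slope k`, and `G + slope k` is nondecreasing from
  -- `x + z` on.
  · obtain ⟨k, hk⟩ := M.exists_inSegment s h.nonneg
    have hk0 := (hM.slope_pos' s hk.1).le
    have h1 := not_lt.1 ((not_congr (h.lt_iff k z hk (hlt.trans_le hz'.2.2))).1 (lt_irrefl z))
    have h2 := add_slope_le_of_crit_le hG hk0 h1 (show x + z ≤ x + z' by linarith)
    have h3 := hM.c_subgradient hk.1 hk.2.1 (fun h => (hk.2.2 h).le) z'
    linarith
  · exact le_rfl
  -- Sending less: power is saved at most at rate `slope k`, while `G + slope k` is nonincreasing up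
  -- to `x + z`. The latter holds because otherwise some `w` slightly below `z` would violate the
  -- criterion.
  · obtain ⟨k, hk, hk1, hk2⟩ := M.exists_segment_left s (hz'.1.trans_lt hlt)
    have hk0 := (hM.slope_pos' s hk).le
    have h1 : x + z ≤ M.crit G k s := by
      by_contra! hcon
      obtain ⟨w, hw1, hw2⟩ := exists_between (max_lt hk1 (show M.crit G k s - x < z by linarith))
      have hseg : M.InSegment k s w :=
        ⟨hk, (le_max_left _ _).trans hw1.le, fun h => hw2.trans_le (hk2 h)⟩
      have h4 := (h.lt_iff k w hseg (hw2.trans_le h.le_zmax)).1 hw2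
      have h5 := (le_max_right _ _).trans_lt hw1
      linarith
    have h2 := add_slope_le_of_le_crit hG hk0 hz'.2.1 (show x + z' ≤ x + z by linarith) h1
    have h3 := hM.c_subgradient hk hk1.le hk2 z'
    linarith

namespace Assumptions

theorem zstar_mem_actions (hM : M.Assumptions) (hx : 0 ≤ x) (s : S) :
    M.zstar x s ∈ M.actions x s :=
  (hM.isThreshold_zstar (Or.inl hx)).mem_actions hM hx

theorem cost_zstar (hM : M.Assumptions) (hx : 0 ≤ x) (s : S) :
    M.c (M.zstar x s) s + M.ginf (x + M.zstar x s) s = M.Vinf x s := by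
  refine IsLeast.unique (s := M.costs M.ginf x s) ⟨⟨_, hM.zstar_mem_actions hx s, rfl⟩, ?_⟩
    (hM.isLeast_Vinf hx s)
  rintro _ ⟨z, hz, rfl⟩
  exact (hM.isThreshold_zstar (Or.inl hx)).cost_le hM (hM.coercive_ginf s) hx hz

theorem measurable_crit_ginf (hM : M.Assumptions) {k : ℕ} (hk : k ≤ M.K) :
    Measurable (M.crit M.ginf k) :=
  measurable_crit hM.coercive_ginf (fun _ hy => hM.costToGo_Vinf.after_measurable hy)
    (fun s => (hM.slope_pos' s hk).le) (hM.slope_meas k hk)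

theorem zstar_nonneg (hM : M.Assumptions) (x : ℝ) (s : S) : 0 ≤ M.zstar x s :=
  Real.sInf_nonneg fun _ hz => (hM.isThreshold_of_isBaseStock (hM.coercive_ginf s) hz).nonneg

/-- For such negative levels no alternative applies and `sInf ∅ = 0`; this matters only because the
decision rule has to be measurable on all of `ℝ × S`. -/
theorem zstar_eq_zero (hM : M.Assumptions)
    (hx : ¬ (0 ≤ x ∨ M.crit M.ginf M.K s - M.zmax s < x)) : M.zstar x s = 0 := by
  push Not at hx
  have : {z : ℝ | M.IsBaseStock M.ginf x s z} = ∅ := by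
    refine Set.eq_empty_of_forall_notMem fun z hz => ?_
    have hth := hM.isThreshold_of_isBaseStock (hM.coercive_ginf s) hz
    rcases hz with ⟨k, hk, h1, _⟩ | ⟨k, hk, h1, _⟩ | ⟨h1, _⟩ | ⟨h1, _⟩
    · have := hM.brkPrev_lt_zmax s hk
      have := hM.crit_le_of_le (hM.coercive_ginf s) hk le_rfl
      linarith
    · have := hM.brkPrev_lt_zmax s (k := k + 1) hk
      rw [brkPrev_succ] at this
      have := hM.crit_le_of_le (hM.coercive_ginf s) hk.le le_rfl
      linarith
    · linarith
    · linarith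
  rw [zstar, this, Real.sInf_empty]

theorem measurable_zstar (hM : M.Assumptions) :
    Measurable fun p : ℝ × S => M.zstar p.1 p.2 := by
  refine measurable_of_Ioi fun a => ?_
  rcases lt_or_ge a 0 with ha | ha
  · have : (fun p : ℝ × S => M.zstar p.1 p.2) ⁻¹' Set.Ioi a = Set.univ :=
      Set.eq_univ_of_forall fun p => ha.trans_le (hM.zstar_nonneg p.1 p.2)
    rw [this]
    exact MeasurableSet.univ
  -- This is the threshold criterion at `w = a`, with `k` the segment that contains `a` in the given
  -- channel condition.
  have hset : (fun p : ℝ × S => M.zstar p.1 p.2) ⁻¹' Set.Ioi a =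
      {p | 0 ≤ p.1 ∨ M.crit M.ginf M.K p.2 - M.zmax p.2 < p.1} ∩ {p | a < M.zmax p.2} ∩
        ⋃ k : ℕ, {p | M.InSegment k p.2 a ∧ p.1 + a < M.crit M.ginf k p.2} := by
    ext ⟨x, s⟩
    simp only [Set.mem_preimage, Set.mem_Ioi, Set.mem_inter_iff, Set.mem_ofPred_eq, Set.mem_iUnion]
    constructor
    · intro h
      have hx : 0 ≤ x ∨ M.crit M.ginf M.K s - M.zmax s < x := by
        by_contra hx
        rw [hM.zstar_eq_zero hx] at h
        linarith
      have hth := hM.isThreshold_zstar hx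
      obtain ⟨k, hk⟩ := M.exists_inSegment s ha
      have hlt := h.trans_le hth.le_zmax
      exact ⟨⟨hx, hlt⟩, k, hk, (hth.lt_iff k a hk hlt).1 h⟩
    · rintro ⟨⟨hx, hlt⟩, k, hk, h⟩
      exact ((hM.isThreshold_zstar hx).lt_iff k a hk hlt).2 h
  have hzmax : Measurable fun p : ℝ × S => M.zmax p.2 := hM.measurable_zmax.comp measurable_snd
  have hcrit : ∀ k ≤ M.K, Measurable fun p : ℝ × S => M.crit M.ginf k p.2 :=
    fun k hk => (hM.measurable_crit_ginf hk).comp measurable_snd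
  rw [hset]
  refine (MeasurableSet.inter ?_ (measurableSet_lt measurable_const hzmax)).inter
    (MeasurableSet.iUnion fun k => ?_)
  · exact (measurableSet_le measurable_const measurable_fst).union
      (measurableSet_lt ((hcrit _ le_rfl).sub hzmax) measurable_fst)
  by_cases hk : k ≤ M.K
  · have h1 : MeasurableSet {p : ℝ × S | M.brkPrev k p.2 ≤ a} :=
      measurableSet_le ((hM.measurable_brkPrev hk).comp measurable_snd) measurable_const
    have h2 : MeasurableSet {p : ℝ × S | k < M.K → a < M.brk k p.2} := by
      by_cases hk' : k < M.K
      · simp only [hk', forall_const]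
        exact measurableSet_lt measurable_const ((hM.brk_meas k hk').comp measurable_snd)
      · simp only [hk', false_imp_iff]
        exact MeasurableSet.univ
    have h3 : MeasurableSet {p : ℝ × S | p.1 + a < M.crit M.ginf k p.2} :=
      measurableSet_lt (measurable_fst.add_const a) (hcrit k hk)
    exact (((MeasurableSet.const (k ≤ M.K)).inter (h1.inter h2)).inter h3)
  · simp only [InSegment, hk, false_and]
    exact MeasurableSet.empty

end Assumptions

end Model

/-! ### Trajectories and the verification argument. -/

namespace Model

variable {S : Type*} [MeasurableSpace S] {M : Model S} {W : ℝ → S → ℝ} {π : Policy S}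
  {x : ℝ} {s : S}

/-- The last slot of a history. -/
def lastSlot (t : ℕ) (w : Finset.Iic t → Slot S) : Slot S := w ⟨t, Finset.mem_Iic.2 le_rfl⟩

theorem measurable_lastSlot (t : ℕ) :
    Measurable (lastSlot t : (Finset.Iic t → Slot S) → Slot S) :=
  measurable_pi_apply _

theorem law_eq_trajMeasure (M : Model S) (π : Policy S) (x : ℝ) (s : S) :
    M.law π x s = Kernel.trajMeasure (X := fun _ => Slot S)
      ((π.first (x, s)).map fun z => ((x, s), z)) (M.step π) := by
  unfold law Kernel.trajMeasure
  rw [Measure.map_map (by fun_prop) (by fun_prop)]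
  rfl

instance isProbabilityMeasure_first (π : Policy S) (x : ℝ) (s : S) :
    IsProbabilityMeasure ((π.first (x, s)).map fun z => (((x, s), z) : Slot S)) :=
  Measure.isProbabilityMeasure_map (by fun_prop)

instance isProbabilityMeasure_law (M : Model S) (π : Policy S) (x : ℝ) (s : S) :
    IsProbabilityMeasure (M.law π x s) := by
  rw [law_eq_trajMeasure]
  infer_instance

/-- The first slots, and the next one given them. -/
theorem map_law_succ (M : Model S) (π : Policy S) (x : ℝ) (s : S) (t : ℕ) :
    (M.law π x s).map (fun ω => (Preorder.frestrictLe (π := fun _ => Slot S) t ω, ω (t + 1))) =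
      ((M.law π x s).map (Preorder.frestrictLe (π := fun _ => Slot S) t)) ⊗ₘ M.step π t := by
  rw [law_eq_trajMeasure]
  exact (Kernel.map_frestrictLe_trajMeasure_compProd_eq_map_trajMeasure).symm

theorem map_law_zero (M : Model S) (π : Policy S) (x : ℝ) (s : S) :
    (M.law π x s).map (fun ω => ω 0) = (π.first (x, s)).map fun z => ((x, s), z) := by
  have h : (M.law π x s).map (Preorder.frestrictLe (π := fun _ => Slot S) 0) =
      (π.first (x, s)).map (fun z => fun _ : Finset.Iic 0 => (((x, s), z) : Slot S)) := by
    unfold law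
    rw [Measure.map_comp _ _ (by fun_prop), Kernel.traj_map_frestrictLe, Kernel.partialTraj_self,
      Measure.id_comp]
  have h2 := congrArg (fun μ => μ.map (lastSlot 0)) h
  rw [Measure.map_map (measurable_lastSlot 0) (by fun_prop),
    Measure.map_map (measurable_lastSlot 0) (by fun_prop)] at h2
  exact h2

theorem lintegral_nextState (M : Model S) (t : ℕ) (w : Finset.Iic t → Slot S)
    {f : ℝ × S → ENNReal} (hf : Measurable f) :
    ∫⁻ p, f p ∂(M.nextState t w) =
      ∫⁻ s', f ((lastSlot t w).1.1 + (lastSlot t w).2 - M.d, s') ∂(M.kernel (lastSlot t w).1.2) := by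
  unfold nextState
  rw [Kernel.prod_apply, Kernel.deterministic_apply, Kernel.comap_apply,
    lintegral_prod _ hf.aemeasurable, lintegral_dirac']
  · rfl
  · exact hf.lintegral_prod_right'

/-- The law of the next state, integrated. -/
theorem lintegral_state_succ (M : Model S) (π : Policy S) (x : ℝ) (s : S) (t : ℕ)
    {f : ℝ × S → ENNReal} (hf : Measurable f) :
    ∫⁻ ω, f (ω (t + 1)).1 ∂(M.law π x s) =
      ∫⁻ ω, ∫⁻ s', f ((ω t).1.1 + (ω t).2 - M.d, s') ∂(M.kernel (ω t).1.2) ∂(M.law π x s) := by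
  have hmeas : Measurable fun p : (Finset.Iic t → Slot S) × Slot S => f p.2.1 :=
    hf.comp (measurable_fst.comp measurable_snd)
  have hstep : ∀ w, ∫⁻ q, f q.1 ∂(M.step π t w) =
      ∫⁻ s', f ((lastSlot t w).1.1 + (lastSlot t w).2 - M.d, s')
        ∂(M.kernel (lastSlot t w).1.2) := by
    intro w
    unfold step
    refine (Kernel.lintegral_compProd (M.nextState t) (π.next t) w
      (hf.comp measurable_fst)).trans ?_
    rw [← lintegral_nextState M t w hf]
    simp
  have h1 : ∫⁻ ω, f (ω (t + 1)).1 ∂(M.law π x s) =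
      ∫⁻ p, f p.2.1 ∂((M.law π x s).map
        fun ω => (Preorder.frestrictLe (π := fun _ => Slot S) t ω, ω (t + 1))) := by
    rw [lintegral_map hmeas (by fun_prop)]
  rw [h1, map_law_succ, Measure.lintegral_compProd hmeas]
  simp only [hstep]
  have hmeas' : Measurable fun w : Finset.Iic t → Slot S => ∫⁻ q, f q.1 ∂(M.step π t w) :=
    (hf.comp measurable_fst).lintegral_kernel
  simp only [hstep] at hmeas'
  rw [lintegral_map hmeas' (by fun_prop)]
  rfl

/-- The buffer dynamics. -/
theorem ae_level_succ (M : Model S) (π : Policy S) (x : ℝ) (s : S) (t : ℕ) :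
    ∀ᵐ ω ∂(M.law π x s), (ω (t + 1)).1.1 = (ω t).1.1 + (ω t).2 - M.d := by
  have hset : MeasurableSet {p : (Finset.Iic t → Slot S) × Slot S |
      p.2.1.1 = (lastSlot t p.1).1.1 + (lastSlot t p.1).2 - M.d} := by
    have := (measurable_lastSlot (S := S) t).comp
      (measurable_fst : Measurable (Prod.fst : (Finset.Iic t → Slot S) × Slot S → _))
    exact measurableSet_eq_fun (by fun_prop)
      (((measurable_fst.comp (measurable_fst.comp this)).add
        (measurable_snd.comp this)).sub_const _)
  have h : ∀ᵐ p ∂(((M.law π x s).map (Preorder.frestrictLe (π := fun _ => Slot S) t)) ⊗ₘ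
      M.step π t), p.2.1.1 = (lastSlot t p.1).1.1 + (lastSlot t p.1).2 - M.d := by
    rw [Measure.ae_compProd_iff hset]
    refine ae_of_all _ fun w => ?_
    have hset' : MeasurableSet {p : ℝ × S |
        p.1 = (lastSlot t w).1.1 + (lastSlot t w).2 - M.d} :=
      measurableSet_eq_fun measurable_fst measurable_const
    unfold step
    refine (Kernel.ae_compProd_iff (measurable_fst hset')).2 ?_
    have hnext : ∀ᵐ p ∂(M.nextState t w),
        p.1 = (lastSlot t w).1.1 + (lastSlot t w).2 - M.d := by
      change M.nextState t w {p | p.1 = (lastSlot t w).1.1 + (lastSlot t w).2 - M.d}ᶜ = 0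
      rw [← lintegral_indicator_one hset'.compl, lintegral_nextState M t w
        (measurable_one.indicator hset'.compl)]
      simp
    filter_upwards [hnext] with p hp
    exact ae_of_all _ fun _ => hp
  rw [← map_law_succ] at h
  exact ae_of_ae_map (by fun_prop) h

/-- A stationary policy acts as it should. -/
theorem ae_action_stationary (M : Model S) {f : ℝ × S → ℝ} (hf : Measurable f) (x : ℝ) (s : S)
    (t : ℕ) : ∀ᵐ ω ∂(M.law (Policy.stationary f hf) x s), (ω t).2 = f (ω t).1 := by
  have hset : MeasurableSet {q : Slot S | q.2 = f q.1} :=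
    measurableSet_eq_fun measurable_snd (hf.comp measurable_fst)
  cases t with
  | zero =>
    have h : ∀ᵐ q ∂(((Policy.stationary f hf).first (x, s)).map fun z => (((x, s), z) : Slot S)),
        q.2 = f q.1 := by
      rw [ae_map_iff (by fun_prop) hset]
      change ∀ᵐ z ∂(Kernel.deterministic f hf (x, s)), z = f (x, s)
      rw [Kernel.deterministic_apply,
        ae_dirac_iff (measurableSet_eq_fun measurable_id' measurable_const)]
    rw [← map_law_zero M] at h
    exact ae_of_ae_map (measurable_pi_apply 0).aemeasurable h
  | succ t =>
    have h : ∀ᵐ p ∂(((M.law (Policy.stationary f hf) x s).map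
        (Preorder.frestrictLe (π := fun _ => Slot S) t)) ⊗ₘ M.step (Policy.stationary f hf) t),
        p.2.2 = f p.2.1 := by
      refine (Measure.ae_compProd_iff (measurable_snd hset)).2 ?_
      refine ae_of_all _ fun w => ?_
      unfold step
      refine (Kernel.ae_compProd_iff hset).2 ?_
      refine ae_of_all _ fun p => ?_
      change ∀ᵐ z ∂(Kernel.deterministic (fun p : (Finset.Iic t → Slot S) × (ℝ × S) => f p.2)
        (hf.comp measurable_snd) (w, p)), z = f p
      rw [Kernel.deterministic_apply,
        ae_dirac_iff (measurableSet_eq_fun measurable_id' measurable_const)]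
    rw [← map_law_succ] at h
    exact ae_of_ae_map (by fun_prop) h

theorem ae_level_zero (M : Model S) (π : Policy S) (x : ℝ) (s : S) :
    ∀ᵐ ω ∂(M.law π x s), (ω 0).1.1 = x := by
  have hset : MeasurableSet {q : Slot S | q.1.1 = x} :=
    measurableSet_eq_fun (measurable_fst.comp measurable_fst) measurable_const
  have h : ∀ᵐ q ∂((π.first (x, s)).map fun z => (((x, s), z) : Slot S)), q.1.1 = x := by
    rw [ae_map_iff (by fun_prop) hset]
    exact ae_of_all _ fun _ => rfl
  rw [← map_law_zero M] at h
  exact ae_of_ae_map (measurable_pi_apply 0).aemeasurable h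

/-- With probability one, the buffer level is nonnegative and the action is feasible in every
slot. -/
def Feasible (M : Model S) (π : Policy S) (x : ℝ) (s : S) : Prop :=
  ∀ t, ∀ᵐ ω ∂(M.law π x s), 0 ≤ (ω t).1.1 ∧ (ω t).2 ∈ M.actions (ω t).1.1 (ω t).1.2

/-- The underflow constraint keeps the next level nonnegative, so feasibility need only be known at
nonnegative levels; this is all that `zstar` guarantees. -/
theorem feasible_of_forall (hx : 0 ≤ x)
    (h : ∀ t, ∀ᵐ ω ∂(M.law π x s), 0 ≤ (ω t).1.1 →
      (ω t).2 ∈ M.actions (ω t).1.1 (ω t).1.2) : M.Feasible π x s := by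
  intro t
  induction t with
  | zero =>
    filter_upwards [M.ae_level_zero π x s, h 0] with ω h0 h1
    have : 0 ≤ (ω 0).1.1 := by rwa [h0]
    exact ⟨this, h1 this⟩
  | succ t ih =>
    filter_upwards [M.ae_level_succ π x s t, ih, h (t + 1)] with ω h1 h2 h3
    have : 0 ≤ (ω (t + 1)).1.1 := by
      rw [h1]
      linarith [(mem_actions.1 h2.2).2.1]
    exact ⟨this, h3 this⟩

theorem Admissible.feasible (hM : M.Assumptions) (hx : 0 ≤ x) (h : M.Admissible π x s) :
    M.Feasible π x s :=
  feasible_of_forall hx fun t => by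
    filter_upwards [h t] with ω hω _
    exact ⟨hω.2, (hM.c_le_iff _ _).1 hω.1⟩

theorem Feasible.admissible (hM : M.Assumptions) (h : M.Feasible π x s) :
    M.Admissible π x s := fun t => by
  filter_upwards [h t] with ω hω
  exact ⟨(hM.c_le_iff _ _).2 hω.2.2, hω.2.1⟩

/-- The expected cost of slot `t`, without discounting. -/
noncomputable def slotCost (M : Model S) (π : Policy S) (x : ℝ) (s : S) (t : ℕ) : ENNReal :=
  ∫⁻ ω, ENNReal.ofReal (M.c (ω t).2 (ω t).1.2 + M.h (max ((ω t).1.1 + (ω t).2 - M.d) 0))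
    ∂(M.law π x s)

/-- The expectation of a function of the state in slot `t`. -/
noncomputable def expectAt (M : Model S) (π : Policy S) (x : ℝ) (s : S) (W : ℝ → S → ℝ) (t : ℕ) :
    ENNReal :=
  ∫⁻ ω, ENNReal.ofReal (W (max (ω t).1.1 0) (ω t).1.2) ∂(M.law π x s)

/-- Nothing is assumed about `h` at negative arguments; the clamped function is monotone on the
whole line. -/
theorem Assumptions.measurable_h (hM : M.Assumptions) : Measurable fun x => M.h (max x 0) :=
  Monotone.measurable fun _ _ h => hM.h_mono (Set.mem_Ici.2 (le_max_right _ _))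
    (Set.mem_Ici.2 (le_max_right _ _)) (max_le_max h le_rfl)

theorem Assumptions.measurable_slotCost (hM : M.Assumptions) (t : ℕ) :
    Measurable fun ω : ℕ → Slot S =>
      ENNReal.ofReal (M.c (ω t).2 (ω t).1.2 + M.h (max ((ω t).1.1 + (ω t).2 - M.d) 0)) := by
  refine ENNReal.measurable_ofReal.comp ((hM.measurable_c.comp (g := M.c.uncurry)
    (f := fun ω : ℕ → Slot S => ((ω t).2, (ω t).1.2)) (by fun_prop)).add ?_)
  exact hM.measurable_h.comp (by fun_prop :
    Measurable fun ω : ℕ → Slot S => (ω t).1.1 + (ω t).2 - M.d)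

/-- Along feasible trajectories the clamp in `slotCost` is inactive. -/
theorem Feasible.cost_eq (hM : M.Assumptions) (h : M.Feasible π x s) (N : ℕ) :
    M.cost π x s N = ∑ t ∈ Finset.range N, ENNReal.ofReal M.α ^ t * M.slotCost π x s t := by
  have hae : ∀ᵐ ω ∂(M.law π x s), ∀ t, 0 ≤ (ω t).1.1 ∧
      (ω t).2 ∈ M.actions (ω t).1.1 (ω t).1.2 := ae_all_iff.2 h
  have h1 : M.cost π x s N = ∫⁻ ω, ∑ t ∈ Finset.range N, ENNReal.ofReal M.α ^ t *
      ENNReal.ofReal (M.c (ω t).2 (ω t).1.2 + M.h (max ((ω t).1.1 + (ω t).2 - M.d) 0))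
        ∂(M.law π x s) := by
    refine lintegral_congr_ae ?_
    filter_upwards [hae] with ω hω
    refine Finset.sum_congr rfl fun t _ => ?_
    have h2 := (mem_actions.1 (hω t).2).2.1
    rw [max_eq_left (by linarith), ENNReal.ofReal_mul (pow_nonneg hM.α_nonneg t),
      ENNReal.ofReal_pow hM.α_nonneg]
  rw [h1, lintegral_finsetSum]
  · refine Finset.sum_congr rfl fun t _ => ?_
    rw [lintegral_const_mul _ (hM.measurable_slotCost t)]
    rfl
  · exact fun t _ => (hM.measurable_slotCost t).const_mul _

theorem CostToGo.expectAt_zero (hW : M.CostToGo W) (π : Policy S) (hx : 0 ≤ x) (s : S) :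
    M.expectAt π x s W 0 = ENNReal.ofReal (W x s) := by
  have hmeas : Measurable fun q : Slot S => ENNReal.ofReal (W (max q.1.1 0) q.1.2) :=
    ENNReal.measurable_ofReal.comp (hW.measurable_uncurry.comp measurable_fst)
  have h : M.expectAt π x s W 0 = ∫⁻ q, ENNReal.ofReal (W (max q.1.1 0) q.1.2)
      ∂((M.law π x s).map fun ω => ω 0) := by
    rw [lintegral_map hmeas (by fun_prop)]
    rfl
  rw [h, map_law_zero, lintegral_map hmeas (by fun_prop)]
  simp [max_eq_left hx]

/-- The cost of slot `t` and the discounted cost-to-go `W` from the next slot on. -/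
theorem CostToGo.lintegral_after (hM : M.Assumptions) (hW : M.CostToGo W)
    (h : M.Feasible π x s) (t : ℕ) :
    ∫⁻ ω, ENNReal.ofReal (M.c (ω t).2 (ω t).1.2 + M.after W ((ω t).1.1 + (ω t).2) (ω t).1.2)
      ∂(M.law π x s) =
    M.slotCost π x s t + ENNReal.ofReal M.α * M.expectAt π x s W (t + 1) := by
  have hmeas : Measurable fun p : ℝ × S => ENNReal.ofReal (W (max p.1 0) p.2) :=
    ENNReal.measurable_ofReal.comp hW.measurable_uncurry
  have h1 : M.expectAt π x s W (t + 1) = ∫⁻ ω, ∫⁻ s',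
      ENNReal.ofReal (W (max ((ω t).1.1 + (ω t).2 - M.d) 0) s') ∂(M.kernel (ω t).1.2)
        ∂(M.law π x s) :=
    M.lintegral_state_succ π x s t hmeas
  have h2 : Measurable fun ω : ℕ → Slot S => ∫⁻ s',
      ENNReal.ofReal (W (max ((ω t).1.1 + (ω t).2 - M.d) 0) s') ∂(M.kernel (ω t).1.2) := by
    have hk : Measurable fun p : ℝ × S =>
        ∫⁻ s', ENNReal.ofReal (W (max p.1 0) s') ∂(M.kernel p.2) :=
      Measurable.lintegral_kernel_prod_right (κ := M.kernel.comap Prod.snd measurable_snd)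
        (hmeas.comp (by fun_prop : Measurable fun q : (ℝ × S) × S => (q.1.1, q.2)))
    exact hk.comp (by fun_prop :
      Measurable fun ω : ℕ → Slot S => ((ω t).1.1 + (ω t).2 - M.d, (ω t).1.2))
  rw [h1, ← lintegral_const_mul _ h2, slotCost, ← lintegral_add_left (hM.measurable_slotCost t)]
  refine lintegral_congr_ae ?_
  filter_upwards [h t] with ω hω
  have hmem := mem_actions.1 hω.2
  have hy : 0 ≤ (ω t).1.1 + (ω t).2 - M.d := by linarith [hmem.2.1]
  have hint : 0 ≤ ∫ s', W ((ω t).1.1 + (ω t).2 - M.d) s' ∂(M.kernel (ω t).1.2) :=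
    integral_nonneg fun s' => hW.nonneg _ hy s'
  rw [max_eq_left hy, ← ofReal_integral_eq_lintegral_ofReal (hW.integrable hy _)
    (ae_of_all _ fun s' => hW.nonneg _ hy s'), ← ENNReal.ofReal_mul hM.α_nonneg,
    ← ENNReal.ofReal_add (add_nonneg (hM.c_nonneg _ hmem.1) (hM.h_nonneg _ hy))
      (mul_nonneg hM.α_nonneg hint), after, add_assoc]

/-- No feasible policy has a smaller cost over `m` slots than the value function. -/
theorem Feasible.V_le (hM : M.Assumptions) (h : M.Feasible π x s) (m n : ℕ) :
    M.expectAt π x s (M.V (n + m)) 0 ≤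
      ∑ t ∈ Finset.range m, ENNReal.ofReal M.α ^ t * M.slotCost π x s t +
        ENNReal.ofReal M.α ^ m * M.expectAt π x s (M.V n) m := by
  induction m generalizing n with
  | zero => simp
  | succ m ih =>
    have hstep : M.expectAt π x s (M.V (n + 1)) m ≤
        M.slotCost π x s m + ENNReal.ofReal M.α * M.expectAt π x s (M.V n) (m + 1) := by
      rw [← (hM.costToGo_V n).lintegral_after hM h m]
      refine lintegral_mono_ae ?_
      filter_upwards [h m] with ω hω
      rw [max_eq_left hω.1]
      exact ENNReal.ofReal_le_ofReal ((hM.isLeast_V n hω.1 _).2 ⟨_, hω.2, rfl⟩)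
    have h1 := ih (n + 1)
    rw [show n + 1 + m = n + (m + 1) by ring] at h1
    refine h1.trans ?_
    rw [Finset.sum_range_succ, add_assoc, pow_succ, mul_assoc, ← mul_add]
    gcongr

/-- With terminal value `V 0 = 0`, `V_le` compares `V m` directly with the cost of `m` slots; no
tail estimate is needed. -/
theorem Feasible.Vinf_le_costInf (hM : M.Assumptions) (h : M.Feasible π x s) (hx : 0 ≤ x) :
    ENNReal.ofReal (M.Vinf x s) ≤ M.costInf π x s := by
  refine le_of_tendsto' (ENNReal.tendsto_ofReal (hM.V_tendsto hx s)) fun m => ?_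
  refine le_trans ?_ (le_iSup (M.cost π x s) m)
  have h1 := h.V_le hM m 0
  rw [zero_add, (hM.costToGo_V m).expectAt_zero π hx, ← h.cost_eq hM] at h1
  simpa [expectAt, V] using h1

variable (hz : Measurable fun p : ℝ × S => M.zstar p.1 p.2)

theorem feasible_zstar (hM : M.Assumptions) (hx : 0 ≤ x) (s : S) :
    M.Feasible (Policy.stationary (fun p : ℝ × S => M.zstar p.1 p.2) hz) x s :=
  feasible_of_forall hx fun t => by
    filter_upwards [M.ae_action_stationary hz x s t] with ω hω h0
    rw [hω]
    exact hM.zstar_mem_actions h0 _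

/-- Each step of `zstar` attains the minimum in the optimality equation, so cost incurred plus
discounted cost-to-go is conserved. -/
theorem expectAt_zstar (hM : M.Assumptions) (hx : 0 ≤ x) (s : S) (m : ℕ) :
    M.cost (Policy.stationary (fun p : ℝ × S => M.zstar p.1 p.2) hz) x s m +
      ENNReal.ofReal M.α ^ m *
        M.expectAt (Policy.stationary (fun p : ℝ × S => M.zstar p.1 p.2) hz) x s M.Vinf m =
      ENNReal.ofReal (M.Vinf x s) := by
  have h := feasible_zstar hz hM hx s
  rw [h.cost_eq hM]
  induction m with
  | zero => simp [hM.costToGo_Vinf.expectAt_zero _ hx]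
  | succ m ih =>
    rw [← ih, Finset.sum_range_succ, add_assoc, pow_succ, mul_assoc, ← mul_add,
      ← hM.costToGo_Vinf.lintegral_after hM h m]
    congr 2
    refine lintegral_congr_ae ?_
    filter_upwards [h m, M.ae_action_stationary hz x s m] with ω hω hact
    rw [max_eq_left hω.1, hact]
    exact congrArg ENNReal.ofReal (hM.cost_zstar hω.1 _)

/-- The upper bound drops the nonnegative remainder, and the lower bound holds for every feasible
policy, so the remainder need not be shown to vanish. -/
theorem costInf_zstar (hM : M.Assumptions) (hx : 0 ≤ x) (s : S) :
    M.costInf (Policy.stationary (fun p : ℝ × S => M.zstar p.1 p.2) hz) x s =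
      ENNReal.ofReal (M.Vinf x s) := by
  refine le_antisymm (iSup_le fun m => ?_) ((feasible_zstar hz hM hx s).Vinf_le_costInf hM hx)
  rw [← expectAt_zstar hz hM hx s m]
  exact le_self_add

theorem isOptimal_zstar (hM : M.Assumptions) :
    M.IsOptimal (Policy.stationary (fun p : ℝ × S => M.zstar p.1 p.2) hz) := by
  refine fun x hx s => ⟨(feasible_zstar hz hM hx s).admissible hM, fun π' hπ' => ?_⟩
  rw [costInf_zstar hz hM hx]
  exact (hπ'.feasible hM hx).Vinf_le_costInf hM hx

end Model

theorem theorem5 {S : Type*} [MeasurableSpace S] (M : Model S) (hM : M.Assumptions) :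
    -- the minima and the expectations of the dynamic program exist
    ((∀ n x, 0 ≤ x → ∀ s, IsLeast
        ((fun z => M.c z s + M.g (n + 1) (x + z) s) '' M.actions x s) (M.V (n + 1) x s)) ∧
      (∀ n x, 0 ≤ x → ∀ s, Integrable (fun s' => M.V n x s') (M.kernel s)) ∧
      (∀ x, 0 ≤ x → ∀ s, Integrable (fun s' => M.Vinf x s') (M.kernel s))) ∧
    -- (a)
    (∀ x, 0 ≤ x → ∀ s, Monotone (fun n => M.V n x s) ∧
      Tendsto (fun n => M.V n x s) atTop (𝓝 (M.Vinf x s))) ∧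
    -- (b)
    (∀ s, ConvexOn ℝ (Set.Ici 0) (fun x => M.Vinf x s)) ∧
    -- (c)
    ((∀ y, M.d ≤ y → ∀ s,
        (∀ m n, 1 ≤ m → m ≤ n → M.g m y s ≤ M.g n y s) ∧
        Tendsto (fun n => M.g n y s) atTop (𝓝 (M.ginf y s))) ∧
      (∀ s, ConvexOn ℝ (Set.Ici M.d) (fun y => M.ginf y s)) ∧
      (∀ s, Tendsto (fun y => M.ginf y s) atTop atTop)) ∧
    -- (d), for the indices `0, …, K` and for the index `-1`
    ((∀ k, k ≤ M.K → ∀ s,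
        Tendsto (fun n => M.crit (M.g n) k s) atTop (𝓝 (M.crit M.ginf k s))) ∧
      (∀ s, Tendsto (fun n => M.critPrev (M.g n) 0 s) atTop (𝓝 (M.critPrev M.ginf 0 s)))) ∧
    -- (e)
    (∀ x, 0 ≤ x → ∀ s,
      IsLeast ((fun z => M.c z s + (M.h (x + z - M.d) +
          M.α * ∫ s', M.Vinf (x + z - M.d) s' ∂(M.kernel s))) '' M.actions x s) (M.Vinf x s) ∧
      (∃! z, M.IsBaseStock M.ginf x s z) ∧
      M.IsBaseStock M.ginf x s (M.zstar x s) ∧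
      M.zstar x s ∈ M.actions x s ∧
      M.c (M.zstar x s) s + M.ginf (x + M.zstar x s) s = M.Vinf x s) ∧
    -- (f)
    (∃ hz : Measurable (fun p : ℝ × S => M.zstar p.1 p.2),
      M.IsOptimal (Policy.stationary (fun p : ℝ × S => M.zstar p.1 p.2) hz) ∧
      ∀ x, 0 ≤ x → ∀ s,
        M.costInf (Policy.stationary (fun p : ℝ × S => M.zstar p.1 p.2) hz) x s =
          ENNReal.ofReal (M.Vinf x s)) := by
  refine ⟨⟨fun n x hx s => hM.isLeast_V n hx s, fun n x hx s => (hM.costToGo_V n).integrable hx s,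
    fun x hx s => hM.costToGo_Vinf.integrable hx s⟩,
    fun x hx s => ⟨hM.V_mono hx s, hM.V_tendsto hx s⟩, hM.costToGo_Vinf.convex,
    ⟨fun y hy s => ⟨fun m n _ hmn => hM.g_mono hmn hy s, hM.g_tendsto hy s⟩,
      fun s => (hM.coercive_ginf s).convex, fun s => (hM.coercive_ginf s).tendsto⟩,
    ⟨fun k hk s => hM.crit_tendsto hk s, fun s => tendsto_const_nhds⟩,
    fun x hx s => ⟨hM.isLeast_Vinf hx s,
      hM.existsUnique_isBaseStock (hM.coercive_ginf s) (Or.inl hx),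
      hM.isBaseStock_zstar (Or.inl hx), hM.zstar_mem_actions hx s, hM.cost_zstar hx s⟩,
    hM.measurable_zstar, Model.isOptimal_zstar _ hM,
    fun x hx s => Model.costInf_zstar _ hM hx s⟩
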